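/- Let $n\ge 3$, $m\ge 1$, and let $\mathcal B:[0,1]\to\mathbb R^3$ be a simple, regular, $C^1$ composite Bézier curve made of $m$ Bézier segments of degree $n$: there are knots $0=\tau_0<\tau_1<\dots<\tau_m=1$ and control points $p_{k,0},\dots,p_{k,n}\in\mathbb R^3$ ($0\le k<m$) with $$\mathcal B(t)=\sum_{j=0}^n\binom nj u^j(1-u)^{n-j}p_{k,j},\qquad u=\frac{t-\tau_k}{\tau_{k+1}-\tau_k},\quad t\in[\tau_k,\tau_{k+1}]$$ (a single Bézier curve is the case $m=1$). Regular means that $\mathcal B'(t)\ne0$ for all $t\in[0,1]$; simple means that $\mathcal B(s)=\mathcal B(t)$ with $s<t$ only if $s=0$, $t=1$ (so $\mathcal B$ may be open or closed). Let $r>0$ be the radius of a non-self-intersecting pipe surface of $\mathcal B$, i.e. the closed normal discs $D_r(t)=\{x:\ (x-\mathcal B(t))\cdot\mathcal B'(t)=0,\ \|x-\mathcal B(t)\|\le r\}$ at different points of the curve are pairwise disjoint. Put $p'_{k,j}=\frac{n}{\tau_{k+1}-\tau_k}(p_{k,j+1}-p_{k,j})$ for $0\le j\le n-1$; write $P=(p_{k,j})$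 and $P'=(p'_{k,j})$ for the corresponding lists of polygons. For such a list $Q=(q_{k,j})_{0\le k<m,\,0\le j\le d}$ let $\Delta_2Q\in\mathbb R^3$ be the vector whose three coordinates are the maxima over $k$ and $0<j<d$ of the absolute values of the corresponding coordinate of $q_{k,j-1}-2q_{k,j}+q_{k,j+1}$. Let $$N_\infty(d)=\frac{\lfloor d/2\rfloor\lceil d/2\rceil}{2d},\qquad M=\max_{k,\;0\le j\le n-2}\|p'_{k,j+1}-p'_{k,j}\|,\qquad \sigma=\min_{t\in[0,1]}\|\mathcal B'(t)\|,$$ $$B'_{dist}(x)=2^{-2x}N_\infty(n-1)\,\|\Delta_2P'\| .$$ Let $N_1$ be any real number with $B'_{dist}(N_1)<\sigma$, i.e. with $N_1>\frac12\log_2\frac{N_\infty(n-1)\|\Delta_2P'\|}{\sigma}$ (for instance the smallest integer with this property, when $\Delta_2P'\neq 0$), and set $$f(\nu)=\frac{2M}{(1-\cos\nu)\,(\sigma-B'_{dist}(N_1))},\qquad N(\nu)=\bigl\lceil\max\{N_1,\log_2f(\nu)\}\bigr\rceil,$$ $$N'(\rho)=\tfrac12\log_2\frac{N_\infty(n)\|\Delta_2P\|}{\rho},\qquad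 N_2=\tfrac12\log_2\frac{2N_\infty(n-1)\|\Delta_2P'\|}{\bigl(1-\frac{\sqrt3}2\bigr)\sigma},$$ $$N^*=\max\Bigl\{N\bigl(\tfrac{\pi}{2(n-1)}\bigr),\ N'\bigl(\tfrac r2\bigr),\ N_2\Bigr\}$$ (with $\log_2 0=-\infty$). Then, for every integer $i\ge0$ with $i\ge\lceil N^*\rceil$, the control polygon obtained from $P$ by $i$ de Casteljau subdivisions with parameter $\frac12$ (the union of its $2^im$ sub-control polygons) is ambient isotopic in $\mathbb R^3$ to the curve $\mathcal B([0,1])$. -/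

import Mathlib

open Set

noncomputable section

namespace BezierIsotopy

/-- Euclidean three-space. -/
abbrev E3 : Type := EuclideanSpace ℝ (Fin 3)

/-- The point with parameter `t` of the Bézier curve of degree `n` with control points
`p 0, …, p n` (later entries of `p` are not used). -/
def bezier (n : ℕ) (p : ℕ → E3) (t : ℝ) : E3 :=
  ∑ j ∈ Finset.range (n + 1), ((n.choose j : ℝ) * t ^ j * (1 - t) ^ (n - j)) • p j

/-- `B`, restricted to `[0,1]`, is the composite Bézier curve made of `m` Bézier segments of
degree `n`: on the knot interval `[τ k, τ (k+1)]`, with `0 = τ 0 < τ 1 < ⋯ < τ m = 1`, it is the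
affinely reparametrized Bézier curve with control points `p k 0, …, p k n`.
A single Bézier curve is the case `m = 1`. -/
structure IsCompositeBezier (m n : ℕ) (τ : ℕ → ℝ) (p : ℕ → ℕ → E3) (B : ℝ → E3) : Prop where
  knot_zero : τ 0 = 0
  knot_last : τ m = 1
  knot_lt : ∀ k < m, τ k < τ (k + 1)
  eq_bezier : ∀ k < m, ∀ t ∈ Icc (τ k) (τ (k + 1)),
    B t = bezier n (p k) ((t - τ k) / (τ (k + 1) - τ k))

/-- The derivative `B'` of a curve parametrized by `[0,1]` (one-sided at the two ends). -/
def velocity (B : ℝ → E3) (t : ℝ) : E3 := derivWithin B (Icc 0 1) t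

/-- A curve is simple if it has no self-intersection; it may be closed, `B 0 = B 1`. -/
def IsSimpleCurve (B : ℝ → E3) : Prop :=
  ∀ s ∈ Icc (0 : ℝ) 1, ∀ t ∈ Icc (0 : ℝ) 1, s < t → B s = B t → s = 0 ∧ t = 1

/-- A curve is regular if its first derivative never vanishes. -/
def IsRegularCurve (B : ℝ → E3) : Prop :=
  ∀ t ∈ Icc (0 : ℝ) 1, velocity B t ≠ 0

/-- The normal disc of radius `r` centred at `B t`. -/
def normalDisc (B : ℝ → E3) (r t : ℝ) : Set E3 :=
  {x | inner ℝ (x - B t) (velocity B t) = 0 ∧ dist x (B t) ≤ r}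

/-- `r` is the radius of a non-self-intersecting pipe surface: the normal discs of radius `r` at
different points of the curve, whose boundary circles sweep out the pipe surface, are disjoint. -/
def PipeNonSelfIntersecting (B : ℝ → E3) (r : ℝ) : Prop :=
  ∀ s ∈ Icc (0 : ℝ) 1, ∀ t ∈ Icc (0 : ℝ) 1, B s ≠ B t →
    Disjoint (normalDisc B r s) (normalDisc B r t)

/-! ### The de Casteljau subdivision with parameter one half -/

/-- One round of taking the midpoints of all the edges of a polygon. -/
def midpoints (p : ℕ → E3) : ℕ → E3 := fun j => midpoint ℝ (p j) (p (j + 1))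

/-- The first of the two polygons produced by the de Casteljau algorithm: the first vertices of
the successive midpoint polygons. -/
def leftPolygon (p : ℕ → E3) : ℕ → E3 := fun j => (midpoints^[j] p) 0

/-- The second of the two polygons produced from `p 0, …, p n` by the de Casteljau algorithm:
the last vertices of the successive midpoint polygons, in reverse order. -/
def rightPolygon (n : ℕ) (p : ℕ → E3) : ℕ → E3 := fun j => (midpoints^[n - j] p) j

/-- One subdivision of a list `Q 0, Q 1, …` of polygons with vertices indexed by `0, …, n`:
the polygon `Q k` is replaced by the two polygons with numbers `2 k` and `2 k + 1`. -/
def subdivide (n : ℕ) (Q : ℕ → ℕ → E3) : ℕ → ℕ → E3 := fun k =>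
  if k % 2 = 0 then leftPolygon (Q (k / 2)) else rightPolygon n (Q (k / 2))

/-- The PL curve made of `m` consecutive polygons with `n` edges each. -/
def plCurve (m n : ℕ) (Q : ℕ → ℕ → E3) : Set E3 :=
  ⋃ k ∈ Finset.range m, ⋃ j ∈ Finset.range n, segment ℝ (Q k j) (Q k (j + 1))

/-- The control polygon after `i` subdivisions: the union of its `m * 2 ^ i` sub-control
polygons. -/
def controlPolygon (m n : ℕ) (p : ℕ → ℕ → E3) (i : ℕ) : Set E3 :=
  plCurve (m * 2 ^ i) n ((subdivide n)^[i] p)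

/-- Two subsets of space are ambient isotopic. -/
def AmbientIsotopic (X Y : Set E3) : Prop :=
  ∃ H : unitInterval → (E3 ≃ₜ E3),
    Continuous (fun z : unitInterval × E3 => H z.1 z.2) ∧
    (∀ x, H 0 x = x) ∧ H 1 '' X = Y

/-! ### The constants -/

/-- The discrete derivative `P'`: the difference quotients of the uniform parametrization of the
control polygon, in which every edge of the `k`-th polygon takes time `(τ (k+1) - τ k) / n`. -/
def discreteDeriv (n : ℕ) (τ : ℕ → ℝ) (p : ℕ → ℕ → E3) : ℕ → ℕ → E3 := fun k j =>
  ((τ (k + 1) - τ k) / n)⁻¹ • (p k (j + 1) - p k j)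

/-- The vector `Δ₂ Q` of the maximal absolute second differences of the three coordinates of `m`
polygons with vertices indexed by `0, …, d`. -/
def delta2 (m d : ℕ) (Q : ℕ → ℕ → E3) : E3 :=
  WithLp.toLp 2 fun c => ⨆ k : Fin m, ⨆ j : Fin (d - 1),
    |Q k j c - 2 * Q k (j + 1) c + Q k (j + 2) c|

/-- `M`: the maximal distance between two consecutive vertices of the discrete derivative. -/
def maxStep (m n : ℕ) (τ : ℕ → ℝ) (p : ℕ → ℕ → E3) : ℝ :=
  ⨆ k : Fin m, ⨆ j : Fin (n - 1),
    ‖discreteDeriv n τ p k (j + 1) - discreteDeriv n τ p k j‖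

/-- `N_∞(d) = ⌊d/2⌋ ⌈d/2⌉ / (2 d)`. -/
def Ninfty (d : ℕ) : ℝ := (⌊(d : ℝ) / 2⌋₊ * ⌈(d : ℝ) / 2⌉₊ : ℝ) / (2 * d)

/-- `σ`: the minimal speed of `B`. -/
def minSpeed (B : ℝ → E3) : ℝ := sInf ((fun t => ‖velocity B t‖) '' Icc (0 : ℝ) 1)

/-- `B'_dist(x) = 2^(-2x) N_∞(n-1) ‖Δ₂ P'‖`. -/
def derivDist (m n : ℕ) (τ : ℕ → ℝ) (p : ℕ → ℕ → E3) (x : ℝ) : ℝ :=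
  1 / (2 : ℝ) ^ (2 * x) * (Ninfty (n - 1) * ‖delta2 m (n - 1) (discreteDeriv n τ p)‖)

/-- `f(ν) = 2 M / ((1 - cos ν) (σ - B'_dist(N₁)))`. -/
def fAngle (m n : ℕ) (τ : ℕ → ℝ) (p : ℕ → ℕ → E3) (B : ℝ → E3) (N₁ ν : ℝ) : ℝ :=
  2 * maxStep m n τ p / ((1 - Real.cos ν) * (minSpeed B - derivDist m n τ p N₁))

/-- `N(ν) = ⌈max {N₁, log₂ f(ν)}⌉`. -/
def NAngle (m n : ℕ) (τ : ℕ → ℝ) (p : ℕ → ℕ → E3) (B : ℝ → E3) (N₁ ν : ℝ) : ℤ :=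
  ⌈max N₁ (Real.logb 2 (fAngle m n τ p B N₁ ν))⌉

/-- `N'(r) = (1/2) log₂ (N_∞(n) ‖Δ₂ P‖ / r)`. -/
def NPipe (m n : ℕ) (p : ℕ → ℕ → E3) (r : ℝ) : ℝ :=
  1 / 2 * Real.logb 2 (Ninfty n * ‖delta2 m n p‖ / r)

/-- `N₂ = (1/2) log₂ (2 N_∞(n-1) ‖Δ₂ P'‖ / ((1 - √3/2) σ))`. -/
def NTangent (m n : ℕ) (τ : ℕ → ℝ) (p : ℕ → ℕ → E3) (B : ℝ → E3) : ℝ :=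
  1 / 2 * Real.logb 2 (2 * Ninfty (n - 1) * ‖delta2 m (n - 1) (discreteDeriv n τ p)‖ /
    ((1 - √3 / 2) * minSpeed B))

/-- `N* = max {N(π/(2(n-1))), N'(r/2), N₂}`.  (The value `0` of the real logarithm at `0`, in
place of `-∞`, does not matter: `N*` is only compared with numbers of subdivisions, which are
non-negative.) -/
def NStar (m n : ℕ) (τ : ℕ → ℝ) (p : ℕ → ℕ → E3) (B : ℝ → E3) (r N₁ : ℝ) : ℝ :=
  max (NAngle m n τ p B N₁ (Real.pi / (2 * ((n : ℝ) - 1))) : ℝ)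
    (max (NPipe m n p (r / 2)) (NTangent m n τ p B))

end BezierIsotopy

end

namespace BezierIsotopy

/-! Everything happens inside the pipe. Let `w` be a continuous normal field along the curve `B`
with `‖w‖ ≤ r / 2`, zero at both ends. Moving each point `x` of the normal disc at `t` by `s (1 - ‖x
- B t‖ / r) w t` keeps every disc in itself, fixes the complement of the solid pipe and, for each
`s` in `[0,1]`, is a homeomorphism of space. Hence the curve is ambient isotopic to its push-off `t
↦ B t + w t` (`ShortNormalField.ambientIsotopic`), and it remains to exhibit the control polygon as
such a push-off.

This is done one Bézier segment at a time. A path with the same ends as an arc, within `r / 2` of it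
and advancing strictly in the direction of every tangent of the arc, meets each normal disc of
radius `r / 2` of the arc exactly once, so it is a push-off (`exists_normalField_of_path`). A
sub-control polygon advances in this way as soon as its edges make pairwise acute angles, because
the tangents of the segment are positive combinations of the edges (`ambientIsotopic_plCurve`).

Two estimates finish the proof. A Bézier curve of degree `d` is within `Ninfty d * ‖Δ₂‖` of its
polygon (`norm_bezier_sub_line_le`), and a subdivision divides the bounds for second differences by
four; this puts the polygon within `r / 2` of the curve. Applied to the derivative, it keeps the
vectors of the discrete derivative longer than `σ - B'_dist(N₁)`. Consecutive ones differ by at most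
`M / 2 ^ i`, so each of the `n - 1` consecutive angles is below `π / (2 (n - 1))` and all angles
within one polygon are acute (`inner_pos_of_norm_sub_le`). -/

/-- The shift operator on sequences of points. -/
noncomputable def shift : Module.End ℝ (ℕ → E3) := LinearMap.funLeft ℝ E3 Nat.succ

/-! ### De Casteljau subdivision as a calculus of polynomials in the shift operator -/

section Operators
open Polynomial

/-- The polynomial of the shift operator that takes the midpoints of the edges. -/
noncomputable def midPoly : ℝ[X] := (1 / 2 : ℝ) • (1 + X)

theorem aeval_shift_mul (f g : ℝ[X]) (p : ℕ → E3) :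
    aeval shift (f * g) p = aeval shift f (aeval shift g p) := by
  rw [map_mul]; rfl

theorem aeval_shift_X_pow (j : ℕ) (p : ℕ → E3) (i : ℕ) :
    aeval shift (X ^ j : ℝ[X]) p i = p (i + j) := by
  induction j generalizing i with
  | zero => simp
  | succ j ih =>
    rw [pow_succ', aeval_shift_mul, aeval_X]
    change aeval shift (X ^ j : ℝ[X]) p (i + 1) = _
    rw [ih]; congr 1; ring

/-- The first entry of the sequence obtained from `p` by a polynomial in the shift operator. -/
noncomputable def evalShift (p : ℕ → E3) : ℝ[X] →ₗ[ℝ] E3 where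
  toFun f := aeval shift f p 0
  map_add' f g := by rw [map_add]; rfl
  map_smul' c f := by rw [map_smul]; rfl

theorem evalShift_shift (p : ℕ → E3) (f g : ℝ[X]) :
    evalShift (aeval shift g p) f = evalShift p (f * g) := by
  change aeval shift f _ 0 = aeval shift (f * g) p 0
  rw [aeval_shift_mul]

theorem C_half_mul_two : (C (2⁻¹ : ℝ) : ℝ[X]) * 2 = 1 := by
  rw [← C_ofNat, ← C_mul]; norm_num

theorem midpoints_eq_aeval (p : ℕ → E3) : midpoints p = aeval shift midPoly p := by
  funext j
  simp only [midpoints, midPoly, map_smul, map_add, map_one, aeval_X]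
  change _ = (1 / 2 : ℝ) • (p j + p (j + 1))
  rw [midpoint_eq_smul_add]; norm_num

theorem iterate_midpoints_eq_aeval (l : ℕ) (p : ℕ → E3) :
    midpoints^[l] p = aeval shift (midPoly ^ l) p := by
  induction l generalizing p with
  | zero => simp
  | succ l ih => rw [Function.iterate_succ_apply, ih, midpoints_eq_aeval, pow_succ, aeval_shift_mul]

theorem leftPolygon_eq_evalShift (p : ℕ → E3) (j : ℕ) :
    leftPolygon p j = evalShift p (midPoly ^ j) := by
  rw [leftPolygon, iterate_midpoints_eq_aeval]; rfl

theorem rightPolygon_eq_evalShift (n : ℕ) (p : ℕ → E3) (j : ℕ) :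
    rightPolygon n p j = evalShift p (X ^ j * midPoly ^ (n - j)) := by
  change _ = aeval shift _ p 0
  rw [rightPolygon, iterate_midpoints_eq_aeval, aeval_shift_mul, aeval_shift_X_pow, zero_add]

/-- The binomial theorem in the commutative ring of polynomials in the shift. With `f = X`, `g = 1`
it describes a Bézier curve; with the midpoint polynomial as `f` or `g` it describes the curves of
the two halves, so that identities between curves reduce to identities between linear polynomials.
-/
theorem sum_bernstein_smul_evalShift (n : ℕ) (p : ℕ → E3) (f g : ℝ[X]) (t : ℝ) :
    ∑ j ∈ Finset.range (n + 1), ((n.choose j : ℝ) * t ^ j * (1 - t) ^ (n - j)) •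
      evalShift p (f ^ j * g ^ (n - j)) = evalShift p ((t • f + (1 - t) • g) ^ n) := by
  rw [add_pow, map_sum]
  refine Finset.sum_congr rfl fun j _ => ?_
  rw [← map_smul]
  congr 1
  simp only [smul_eq_C_mul, map_mul, map_pow, mul_pow, map_natCast]; ring

theorem bezier_eq_evalShift (n : ℕ) (p : ℕ → E3) (t : ℝ) :
    bezier n p t = evalShift p ((t • X + (1 - t) • 1 : ℝ[X]) ^ n) := by
  rw [← sum_bernstein_smul_evalShift, bezier]
  refine Finset.sum_congr rfl fun j _ => ?_
  rw [one_pow, mul_one]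
  change _ = _ • aeval shift (X ^ j : ℝ[X]) p 0
  rw [aeval_shift_X_pow, zero_add]

theorem bezier_leftPolygon (n : ℕ) (p : ℕ → E3) (t : ℝ) :
    bezier n (leftPolygon p) t = bezier n p (t / 2) := by
  have h := sum_bernstein_smul_evalShift n p midPoly 1 t
  simp only [one_pow, mul_one, ← leftPolygon_eq_evalShift] at h
  rw [bezier, h, bezier_eq_evalShift]
  congr 2
  simp only [midPoly, smul_eq_C_mul, map_sub, map_one, div_eq_mul_inv, map_mul, one_mul]
  linear_combination (C t) * C_half_mul_two

theorem bezier_rightPolygon (n : ℕ) (p : ℕ → E3) (t : ℝ) :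
    bezier n (rightPolygon n p) t = bezier n p ((1 + t) / 2) := by
  have h := sum_bernstein_smul_evalShift n p X midPoly t
  simp only [← rightPolygon_eq_evalShift] at h
  rw [bezier, h, bezier_eq_evalShift]
  congr 2
  simp only [midPoly, smul_eq_C_mul, map_sub, map_one, div_eq_mul_inv, map_mul, map_add, one_mul]
  linear_combination (1 - C t * X) * C_half_mul_two

/-- The sequences of edge vectors of a list of polygons. -/
def edges (Q : ℕ → ℕ → E3) : ℕ → ℕ → E3 := fun k j => Q k (j + 1) - Q k j

theorem aeval_shift_sub_one (p : ℕ → E3) :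
    aeval shift (X - 1 : ℝ[X]) p = fun j => p (j + 1) - p j := by
  rw [map_sub, aeval_X, map_one]; rfl

/-- Taking edges is multiplication by `X - 1`, and `midPoly - 1 = (X - 1) / 2`. -/
theorem leftPolygon_succ_sub (p : ℕ → E3) (j : ℕ) :
    leftPolygon p (j + 1) - leftPolygon p j =
      (1 / 2 : ℝ) • leftPolygon (fun j => p (j + 1) - p j) j := by
  simp only [leftPolygon_eq_evalShift, ← aeval_shift_sub_one, evalShift_shift]
  rw [← map_sub, ← map_smul]
  congr 1
  simp only [midPoly, smul_eq_C_mul, one_div]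
  linear_combination ((C (2⁻¹ : ℝ) * (1 + X)) ^ j) * C_half_mul_two

/-- The same computation with `X - midPoly = (X - 1) / 2`; the degree drops by one because the
exponents of `X` and `midPoly` always add up to the degree. -/
theorem rightPolygon_succ_sub (n : ℕ) (p : ℕ → E3) {j : ℕ} (hj : j ≤ n) :
    rightPolygon (n + 1) p (j + 1) - rightPolygon (n + 1) p j =
      (1 / 2 : ℝ) • rightPolygon n (fun j => p (j + 1) - p j) j := by
  simp only [rightPolygon_eq_evalShift, ← aeval_shift_sub_one, evalShift_shift]
  rw [← map_sub, ← map_smul]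
  congr 1
  obtain ⟨l, rfl⟩ := Nat.exists_eq_add_of_le hj
  have e1 : j + l + 1 - (j + 1) = l := by omega
  have e2 : j + l + 1 - j = l + 1 := by omega
  have e3 : j + l - j = l := by omega
  rw [e1, e2, e3]
  simp only [midPoly, smul_eq_C_mul, one_div]
  linear_combination (-X * X ^ j * (C (2⁻¹ : ℝ) * (1 + X)) ^ l) * C_half_mul_two

end Operators

/-! ### Subdivision of lists of polygons: knots, derivatives and differences -/

theorem subdivide_two_mul (n : ℕ) (Q : ℕ → ℕ → E3) (k : ℕ) :
    subdivide n Q (2 * k) = leftPolygon (Q k) := by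
  simp [subdivide]

theorem subdivide_two_mul_add_one (n : ℕ) (Q : ℕ → ℕ → E3) (k : ℕ) :
    subdivide n Q (2 * k + 1) = rightPolygon n (Q k) := by
  have h1 : (2 * k + 1) % 2 = 1 := by omega
  have h2 : (2 * k + 1) / 2 = k := by omega
  simp [subdivide, h1, h2]

theorem edges_subdivide (n : ℕ) (Q : ℕ → ℕ → E3) (k : ℕ) {j : ℕ} (hj : j ≤ n) :
    edges (subdivide (n + 1) Q) k j = (1 / 2 : ℝ) • subdivide n (edges Q) k j := by
  unfold edges
  obtain ⟨l, rfl | rfl⟩ := Nat.even_or_odd' k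
  · rw [subdivide_two_mul, subdivide_two_mul, leftPolygon_succ_sub]
  · rw [subdivide_two_mul_add_one, subdivide_two_mul_add_one, rightPolygon_succ_sub _ _ hj]

theorem edges_edges_subdivide (n : ℕ) (Q : ℕ → ℕ → E3) (k : ℕ) {j : ℕ} (hj : j ≤ n) :
    edges (edges (subdivide (n + 2) Q)) k j =
      (1 / 4 : ℝ) • subdivide n (edges (edges Q)) k j := by
  have h := edges_subdivide n (edges Q) k hj
  unfold edges at h ⊢
  have h1 := edges_subdivide (n + 1) Q k (j := j) (by omega)
  have h2 := edges_subdivide (n + 1) Q k (j := j + 1) (by omega)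
  unfold edges at h1 h2
  rw [h1, h2, ← smul_sub, h, smul_smul]; norm_num

theorem iterate_midpoints_mem {C : Set E3} (hC : Convex ℝ C) {n : ℕ} {p : ℕ → E3}
    (h : ∀ j ≤ n, p j ∈ C) (l j : ℕ) (hj : l + j ≤ n) : midpoints^[l] p j ∈ C := by
  induction l generalizing j with
  | zero => exact h j (by omega)
  | succ l ih =>
    rw [Function.iterate_succ_apply']
    exact hC.midpoint_mem (ih j (by omega)) (ih (j + 1) (by omega))

/-- Only midpoints are taken, so any convex set containing the old vertices contains the new ones.
Applied to boxes and balls of differences, this propagates all the bounds. -/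
theorem subdivide_mem {C : Set E3} (hC : Convex ℝ C) {m n : ℕ} {Q : ℕ → ℕ → E3}
    (h : ∀ k < m, ∀ j ≤ n, Q k j ∈ C) (k : ℕ) (hk : k < m * 2) (j : ℕ) (hj : j ≤ n) :
    subdivide n Q k j ∈ C := by
  obtain ⟨l, rfl | rfl⟩ := Nat.even_or_odd' k
  · rw [subdivide_two_mul]
    exact iterate_midpoints_mem hC (h l (by omega)) j 0 (by omega)
  · rw [subdivide_two_mul_add_one]
    exact iterate_midpoints_mem hC (h l (by omega)) (n - j) j (by omega)

/-- Induction on the degree: differentiate the de Casteljau recursion `rec_eq` by the product rule.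
-/
theorem hasDerivAt_bezier (n : ℕ) (p : ℕ → E3) (t : ℝ) :
    HasDerivAt (bezier (n + 1) p) (((n : ℝ) + 1) • bezier n (fun j => p (j + 1) - p j) t) t := by
  have rec_eq : ∀ (n : ℕ) (p : ℕ → E3) (t : ℝ), bezier (n + 1) p t =
      (1 - t) • bezier n p t + t • bezier n (fun j => p (j + 1)) t := by
    intro n p t
    have : (fun j => p (j + 1)) = Polynomial.aeval shift (Polynomial.X : Polynomial ℝ) p := by
      rw [Polynomial.aeval_X]; rfl
    simp only [bezier_eq_evalShift, this, evalShift_shift]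
    rw [← map_smul, ← map_smul, ← map_add]
    congr 1
    simp only [Polynomial.smul_eq_C_mul]; ring
  have sub_eq : ∀ (n : ℕ) (p q : ℕ → E3) (t : ℝ),
      bezier n (fun j => p j - q j) t = bezier n p t - bezier n q t := by
    intro n p q t
    simp only [bezier, smul_sub, Finset.sum_sub_distrib]
  induction n generalizing p with
  | zero =>
    have h : bezier 1 p = fun t => (1 - t) • p 0 + t • p 1 := by
      funext t; rw [rec_eq]; simp [bezier]
    rw [h]
    have h1 := (((hasDerivAt_id t).const_sub 1).smul_const (p 0)).add
      ((hasDerivAt_id t).smul_const (p 1))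
    refine h1.congr_deriv ?_
    simp only [bezier]; simp; abel
  | succ n ih =>
    have h : bezier (n + 1 + 1) p = fun t => (1 - t) • bezier (n + 1) p t +
        t • bezier (n + 1) (fun j => p (j + 1)) t := funext fun t => rec_eq _ _ _
    rw [h]
    have h1 := (((hasDerivAt_id t).const_sub 1).smul (ih p)).add
      ((hasDerivAt_id t).smul (ih fun j => p (j + 1)))
    refine h1.congr_deriv ?_
    have e := sub_eq (n + 1) (fun j => p (j + 1)) p t
    rw [Nat.cast_add_one, add_smul ((n : ℝ) + 1) 1, one_smul]
    nth_rewrite 2 [e]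
    rw [rec_eq n fun j => p (j + 1) - p j]
    simp only [id]
    module

/-- The knots together with the midpoints of the knot intervals. -/
noncomputable def refineKnots (τ : ℕ → ℝ) (k : ℕ) : ℝ := (τ (k / 2) + τ ((k + 1) / 2)) / 2

theorem refineKnots_two_mul (τ : ℕ → ℝ) (k : ℕ) : refineKnots τ (2 * k) = τ k := by
  have h1 : 2 * k / 2 = k := by omega
  have h2 : (2 * k + 1) / 2 = k := by omega
  rw [refineKnots, h1, h2]; ring

theorem refineKnots_two_mul_add_one (τ : ℕ → ℝ) (k : ℕ) :
    refineKnots τ (2 * k + 1) = (τ k + τ (k + 1)) / 2 := by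
  have h1 : (2 * k + 1 + 1) / 2 = k + 1 := by omega
  have h2 : (2 * k + 1) / 2 = k := by omega
  rw [refineKnots, h1, h2]

theorem refineKnots_sub (τ : ℕ → ℝ) (k : ℕ) :
    refineKnots τ (k + 1) - refineKnots τ k = (τ (k / 2 + 1) - τ (k / 2)) / 2 := by
  obtain ⟨l, rfl | rfl⟩ := Nat.even_or_odd' k
  · have h1 : 2 * l / 2 = l := by omega
    rw [refineKnots_two_mul, refineKnots_two_mul_add_one, h1]; ring
  · have h1 : (2 * l + 1) / 2 = l := by omega
    have h2 : 2 * l + 1 + 1 = 2 * (l + 1) := by ring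
    rw [refineKnots_two_mul_add_one, h2, refineKnots_two_mul, h1]; ring

theorem IsCompositeBezier.subdivide {m n : ℕ} {τ : ℕ → ℝ} {p : ℕ → ℕ → E3} {B : ℝ → E3}
    (h : IsCompositeBezier m n τ p B) :
    IsCompositeBezier (m * 2) n (refineKnots τ) (subdivide n p) B := by
  refine ⟨?_, ?_, fun k hk => ?_, fun k hk t ht => ?_⟩
  · simpa [h.knot_zero] using refineKnots_two_mul τ 0
  · rw [mul_comm, refineKnots_two_mul, h.knot_last]
  · have h1 := refineKnots_sub τ k
    have h2 := h.knot_lt (k / 2) (by omega)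
    linarith
  · obtain ⟨l, rfl | rfl⟩ := Nat.even_or_odd' k
    · have hl := h.knot_lt l (by omega)
      rw [refineKnots_two_mul, refineKnots_two_mul_add_one] at ht ⊢
      rw [subdivide_two_mul, bezier_leftPolygon, h.eq_bezier l (by omega) t
        ⟨ht.1, by linarith [ht.2]⟩]
      congr 1
      have h4 : (τ l + τ (l + 1)) / 2 - τ l = (τ (l + 1) - τ l) / 2 := by ring
      rw [h4]
      field_simp
    · have hl := h.knot_lt l (by omega)
      have h2 : 2 * l + 1 + 1 = 2 * (l + 1) := by ring
      rw [h2, refineKnots_two_mul, refineKnots_two_mul_add_one] at ht ⊢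
      rw [subdivide_two_mul_add_one, bezier_rightPolygon, h.eq_bezier l (by omega) t
        ⟨by linarith [ht.1], ht.2⟩]
      congr 1
      have h3 : τ (l + 1) - τ l ≠ 0 := by linarith
      have h4 : τ (l + 1) - (τ l + τ (l + 1)) / 2 = (τ (l + 1) - τ l) / 2 := by ring
      rw [h4]
      field_simp
      ring

theorem subdivide_smul (n : ℕ) (c : ℕ → ℝ) (Q : ℕ → ℕ → E3) (k j : ℕ) :
    subdivide n (fun k j => c k • Q k j) k j = c (k / 2) • subdivide n Q k j := by
  have key : ∀ (l : ℕ) (c : ℝ) (p : ℕ → E3) (j : ℕ),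
      midpoints^[l] (fun j => c • p j) j = c • midpoints^[l] p j := by
    intro l c p j
    rw [iterate_midpoints_eq_aeval, iterate_midpoints_eq_aeval]
    change Polynomial.aeval shift (midPoly ^ l) (c • p) j = _
    rw [map_smul]; rfl
  unfold subdivide
  split_ifs
  · exact key j _ _ 0
  · exact key (n - j) _ _ j

/-- Edges and knot intervals are both halved, so the factors cancel: the discrete derivative is
itself subdivided, as a polygon of one degree less. -/
theorem discreteDeriv_subdivide (n : ℕ) (τ : ℕ → ℝ) (p : ℕ → ℕ → E3) (k : ℕ) {j : ℕ}
    (hj : j ≤ n) :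
    discreteDeriv (n + 1) (refineKnots τ) (subdivide (n + 1) p) k j =
      subdivide n (discreteDeriv (n + 1) τ p) k j := by
  have h1 := edges_subdivide n p k hj
  have h2 := subdivide_smul n (fun k => ((τ (k + 1) - τ k) / (n + 1 : ℕ))⁻¹) (edges p) k j
  change _ • edges (subdivide (n + 1) p) k j = _
  rw [h1, refineKnots_sub, smul_smul]
  refine Eq.trans ?_ h2.symm
  congr 1
  rw [div_right_comm, inv_div, one_div, div_eq_mul_inv]
  ring

/-- Bounds for the second differences of the polygons and of their discrete derivatives, and for
the first differences of the latter. -/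
structure DifferenceBounds (m n : ℕ) (τ : ℕ → ℝ) (p : ℕ → ℕ → E3) (δ δ' : Fin 3 → ℝ) (M : ℝ) :
    Prop where
  polygon : ∀ k < m, ∀ j ≤ n + 1, ∀ c, |edges (edges p) k j c| ≤ δ c
  deriv : ∀ k < m, ∀ j ≤ n, ∀ c, |edges (edges (discreteDeriv (n + 3) τ p)) k j c| ≤ δ' c
  step : ∀ k < m, ∀ j ≤ n + 1, ‖edges (discreteDeriv (n + 3) τ p) k j‖ ≤ M

theorem convex_abs_coord_le (δ : Fin 3 → ℝ) : Convex ℝ {x : E3 | ∀ c, |x c| ≤ δ c} := by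
  intro x hx y hy a b ha hb hab c
  calc |a * x c + b * y c| ≤ |a * x c| + |b * y c| := abs_add_le _ _
    _ = a * |x c| + b * |y c| := by rw [abs_mul, abs_mul, abs_of_nonneg ha, abs_of_nonneg hb]
    _ ≤ a * δ c + b * δ c := by gcongr <;> [exact hx c; exact hy c]
    _ = δ c := by rw [← add_mul, hab, one_mul]

theorem DifferenceBounds.subdivide {m n : ℕ} {τ : ℕ → ℝ} {p : ℕ → ℕ → E3} {δ δ' : Fin 3 → ℝ}
    {M : ℝ} (h : DifferenceBounds m n τ p δ δ' M) :
    DifferenceBounds (m * 2) n (refineKnots τ) (subdivide (n + 3) p) (fun c => δ c / 4)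
      (fun c => δ' c / 4) (M / 2) := by
  have scale : ∀ (a b : ℝ) (x : E3) (c : Fin 3), 0 < b → |x c| ≤ a →
      |((1 / b : ℝ) • x) c| ≤ a / b := by
    intro a b x c hb hx
    rw [PiLp.smul_apply, smul_eq_mul, abs_mul, abs_of_pos (by positivity), div_eq_inv_mul a,
      one_div]
    gcongr
  refine ⟨fun k hk j hj c => ?_, fun k hk j hj c => ?_, fun k hk j hj => ?_⟩
  · rw [edges_edges_subdivide (n + 1) p k hj]
    exact scale _ _ _ _ (by norm_num) (subdivide_mem (convex_abs_coord_le δ) h.polygon k hk j hj c)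
  · have e : edges (edges (discreteDeriv (n + 3) (refineKnots τ)
        (BezierIsotopy.subdivide (n + 3) p))) k j =
        edges (edges (BezierIsotopy.subdivide (n + 2) (discreteDeriv (n + 3) τ p))) k j := by
      simp only [edges]
      rw [discreteDeriv_subdivide (n + 2) τ p k (by omega : j ≤ n + 2),
        discreteDeriv_subdivide (n + 2) τ p k (by omega : j + 1 ≤ n + 2),
        discreteDeriv_subdivide (n + 2) τ p k (by omega : j + 1 + 1 ≤ n + 2)]
    rw [e, edges_edges_subdivide n _ k hj]
    exact scale _ _ _ _ (by norm_num) (subdivide_mem (convex_abs_coord_le δ') h.deriv k hk j hj c)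
  · have e : edges (discreteDeriv (n + 3) (refineKnots τ)
        (BezierIsotopy.subdivide (n + 3) p)) k j =
        edges (BezierIsotopy.subdivide (n + 2) (discreteDeriv (n + 3) τ p)) k j := by
      simp only [edges]
      rw [discreteDeriv_subdivide (n + 2) τ p k (by omega : j ≤ n + 2),
        discreteDeriv_subdivide (n + 2) τ p k (by omega : j + 1 ≤ n + 2)]
    have := subdivide_mem (convex_closedBall (0 : E3) M)
      (fun k hk j hj => mem_closedBall_zero_iff.2 (h.step k hk j hj)) k hk j hj
    rw [mem_closedBall_zero_iff] at this
    rw [e, edges_subdivide (n + 1) _ k hj, norm_smul]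
    norm_num
    linarith

theorem exists_refinement {m n : ℕ} {τ : ℕ → ℝ} {p : ℕ → ℕ → E3} {B : ℝ → E3} {δ δ' : Fin 3 → ℝ}
    {M : ℝ} (h : IsCompositeBezier m (n + 3) τ p B) (hb : DifferenceBounds m n τ p δ δ' M)
    (i : ℕ) : ∃ τ', IsCompositeBezier (m * 2 ^ i) (n + 3) τ' ((subdivide (n + 3))^[i] p) B ∧
      DifferenceBounds (m * 2 ^ i) n τ' ((subdivide (n + 3))^[i] p) (fun c => δ c / 4 ^ i)
        (fun c => δ' c / 4 ^ i) (M / 2 ^ i) := by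
  induction i with
  | zero => exact ⟨τ, by simpa using h, by simpa using hb⟩
  | succ i ih =>
    obtain ⟨τ', h1, h2⟩ := ih
    refine ⟨refineKnots τ', ?_, ?_⟩
    · rw [pow_succ, ← mul_assoc, Function.iterate_succ_apply']; exact h1.subdivide
    · rw [pow_succ, ← mul_assoc, Function.iterate_succ_apply']
      simpa only [pow_succ, div_div] using h2.subdivide

theorem IsCompositeBezier.knot_mono {m n : ℕ} {τ : ℕ → ℝ} {p : ℕ → ℕ → E3} {B : ℝ → E3}
    (h : IsCompositeBezier m n τ p B) {j k : ℕ} (hjk : j ≤ k) (hk : k ≤ m) : τ j ≤ τ k := by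
  induction k, hjk using Nat.le_induction with
  | base => exact le_rfl
  | succ k _ ih => exact (ih (by omega)).trans (h.knot_lt k (by omega)).le

theorem IsCompositeBezier.Icc_subset {m n : ℕ} {τ : ℕ → ℝ} {p : ℕ → ℕ → E3} {B : ℝ → E3}
    (h : IsCompositeBezier m n τ p B) {k : ℕ} (hk : k < m) :
    Icc (τ k) (τ (k + 1)) ⊆ Icc 0 1 := by
  have h1 := h.knot_mono (Nat.zero_le k) hk.le
  have h2 := h.knot_mono (show k + 1 ≤ m from hk) le_rfl
  rw [h.knot_zero] at h1
  rw [h.knot_last] at h2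
  exact Icc_subset_Icc h1 h2

theorem IsCompositeBezier.exists_mem_Icc {m n : ℕ} {τ : ℕ → ℝ} {p : ℕ → ℕ → E3} {B : ℝ → E3}
    (h : IsCompositeBezier m n τ p B) {t : ℝ} (ht : t ∈ Icc (0 : ℝ) 1) :
    ∃ k < m, t ∈ Icc (τ k) (τ (k + 1)) := by
  have key : ∀ k ≤ m, 0 < k → t ≤ τ k → ∃ k < m, t ∈ Icc (τ k) (τ (k + 1)) := by
    intro k
    induction k with
    | zero => intro _ h0; omega
    | succ k ih =>
      intro hk _ htk
      rcases le_total (τ k) t with h1 | h1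
      · exact ⟨k, hk, h1, htk⟩
      · rcases Nat.eq_zero_or_pos k with rfl | h0
        · exact ⟨0, hk, by rw [h.knot_zero]; exact ht.1, htk⟩
        · exact ih (by omega) h0 h1
  refine key m le_rfl ?_ (by rw [h.knot_last]; exact ht.2)
  rcases Nat.eq_zero_or_pos m with rfl | h0
  · have := h.knot_zero.symm.trans h.knot_last; norm_num at this
  · exact h0

theorem IsCompositeBezier.velocity_eq {m n : ℕ} {τ : ℕ → ℝ} {p : ℕ → ℕ → E3} {B : ℝ → E3}
    (h : IsCompositeBezier m (n + 1) τ p B) (hC1 : ContDiffOn ℝ 1 B (Icc 0 1)) {k : ℕ} (hk : k < m)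
    {t : ℝ} (ht : t ∈ Icc (τ k) (τ (k + 1))) :
    velocity B t = bezier n (discreteDeriv (n + 1) τ p k) ((t - τ k) / (τ (k + 1) - τ k)) := by
  have hlt := h.knot_lt k hk
  have h1 : HasDerivWithinAt B (velocity B t) (Icc (τ k) (τ (k + 1))) t :=
    ((hC1.differentiableOn (by norm_num) t (h.Icc_subset hk ht)).hasDerivWithinAt).mono
      (h.Icc_subset hk)
  have h2 : HasDerivAt (fun s => (s - τ k) / (τ (k + 1) - τ k)) (τ (k + 1) - τ k)⁻¹ t := by
    have := ((hasDerivAt_id t).sub_const (τ k)).div_const (τ (k + 1) - τ k)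
    simpa [one_div] using this
  have h3 := ((hasDerivAt_bezier n (p k) _).scomp t h2).hasDerivWithinAt
    (s := Icc (τ k) (τ (k + 1)))
  have h4 := h3.congr (f₁ := B) (fun s hs => h.eq_bezier k hk s hs) (h.eq_bezier k hk t ht)
  -- At a knot the derivative within `[0,1]` restricts to the one-sided derivative within the chosen
  -- knot interval, and the latter is unique; either adjacent segment therefore gives the same
  -- velocity.
  have h5 := (uniqueDiffOn_Icc hlt t ht).eq_deriv _ h1 h4
  rw [h5]
  unfold discreteDeriv bezier
  rw [smul_smul, Finset.smul_sum]
  refine Finset.sum_congr rfl fun j _ => ?_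
  rw [smul_smul, smul_smul]
  congr 1
  rw [inv_div, div_eq_inv_mul]; push_cast; ring

/-! ### Distance between a Bézier curve and its control polygon -/

theorem sum_bernstein (d : ℕ) (u : ℝ) :
    ∑ j ∈ Finset.range (d + 1), (d.choose j : ℝ) * u ^ j * (1 - u) ^ (d - j) = 1 := by
  simpa [bernsteinPolynomial, Polynomial.eval_finsetSum] using
    congrArg (Polynomial.eval u) (bernsteinPolynomial.sum ℝ d)

theorem sum_bernstein_mul (d : ℕ) (u : ℝ) :
    ∑ j ∈ Finset.range (d + 1), (d.choose j : ℝ) * u ^ j * (1 - u) ^ (d - j) * j = d * u := by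
  have := congrArg (Polynomial.eval u) (bernsteinPolynomial.sum_smul ℝ d)
  simp only [bernsteinPolynomial, Polynomial.eval_finsetSum, nsmul_eq_mul, Polynomial.eval_mul,
    Polynomial.eval_natCast, Polynomial.eval_pow, Polynomial.eval_X, Polynomial.eval_sub,
    Polynomial.eval_one] at this
  rw [← this]
  exact Finset.sum_congr rfl fun j _ => by ring

theorem sum_bernstein_mul_sq (d : ℕ) (u : ℝ) :
    ∑ j ∈ Finset.range (d + 1), (d.choose j : ℝ) * u ^ j * (1 - u) ^ (d - j) * (j : ℝ) ^ 2 =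
      d * (d - 1) * u ^ 2 + d * u := by
  have := congrArg (Polynomial.eval u) (bernsteinPolynomial.sum_mul_smul ℝ d)
  simp only [bernsteinPolynomial, Polynomial.eval_finsetSum, nsmul_eq_mul, Polynomial.eval_mul,
    Polynomial.eval_natCast, Polynomial.eval_pow, Polynomial.eval_X, Polynomial.eval_sub,
    Polynomial.eval_one] at this
  have cast_mul_pred : ∀ j : ℕ, ((j * (j - 1) : ℕ) : ℝ) = (j : ℝ) * (j - 1) := by
    rintro (_ | j) <;> simp
  simp only [cast_mul_pred] at this
  rw [← this, ← sum_bernstein_mul d u, ← Finset.sum_add_distrib]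
  exact Finset.sum_congr rfl fun j _ => by ring

/-- A convex sequence lies above the line through two consecutive entries. -/
theorem line_le_of_convex {d j : ℕ} {c : ℕ → ℝ} (hj : j < d)
    (hc : ∀ i, i + 2 ≤ d → 0 ≤ c i - 2 * c (i + 1) + c (i + 2)) {i : ℕ} (hi : i ≤ d) :
    c j + ((i : ℝ) - j) * (c (j + 1) - c j) ≤ c i := by
  have slope : ∀ a b, a ≤ b → b + 1 ≤ d → c (a + 1) - c a ≤ c (b + 1) - c b := by
    intro a b hab
    induction b, hab using Nat.le_induction with
    | base => intro _; exact le_rfl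
    | succ b _ ih =>
      intro hb
      have := hc b (by omega)
      have := ih (by omega)
      rw [show b + 1 + 1 = b + 2 from rfl]
      linarith
  rcases le_total j i with h | h
  · induction i, h using Nat.le_induction with
    | base => simp
    | succ i hji ih =>
      have h1 := ih (by omega)
      have h2 := slope j i hji hi
      push_cast
      linarith
  · have key : ∀ l i, i + l = j → c j + ((i : ℝ) - j) * (c (j + 1) - c j) ≤ c i := by
      intro l
      induction l with
      | zero => rintro i rfl; simp
      | succ l ih =>
        intro i hi
        have h1 := ih (i + 1) (by omega)
        have h2 := slope i j (by omega) hj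
        push_cast at h1
        linarith
    exact key (j - i) i (by omega)

/-- The Bernstein weights are nonnegative with total mass 1 and mean `d * u`, so averaging the
affine minorant of a convex sequence gives its value at `d * u` (Jensen). -/
theorem line_le_sum_bernstein {d j : ℕ} {c : ℕ → ℝ} (hj : j < d)
    (hc : ∀ i, i + 2 ≤ d → 0 ≤ c i - 2 * c (i + 1) + c (i + 2)) {u : ℝ} (hu : u ∈ Icc (0 : ℝ) 1) :
    c j + (d * u - j) * (c (j + 1) - c j) ≤
      ∑ i ∈ Finset.range (d + 1), (d.choose i : ℝ) * u ^ i * (1 - u) ^ (d - i) * c i := by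
  have h1 : c j + (d * u - j) * (c (j + 1) - c j) =
      ∑ i ∈ Finset.range (d + 1), (d.choose i : ℝ) * u ^ i * (1 - u) ^ (d - i) *
        (c j + ((i : ℝ) - j) * (c (j + 1) - c j)) := by
    have e : ∀ i : ℕ, (d.choose i : ℝ) * u ^ i * (1 - u) ^ (d - i) *
        (c j + ((i : ℝ) - j) * (c (j + 1) - c j)) =
        (d.choose i : ℝ) * u ^ i * (1 - u) ^ (d - i) * (c j - j * (c (j + 1) - c j)) +
        (d.choose i : ℝ) * u ^ i * (1 - u) ^ (d - i) * i * (c (j + 1) - c j) :=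
      fun i => by ring
    simp only [e]
    rw [Finset.sum_add_distrib, ← Finset.sum_mul, ← Finset.sum_mul, sum_bernstein,
      sum_bernstein_mul]
    ring
  rw [h1]
  refine Finset.sum_le_sum fun i hi => ?_
  have h0 : 0 ≤ 1 - u := by linarith [hu.2]
  have h0' := hu.1
  have := line_le_of_convex hj hc (Nat.lt_succ_iff.1 (Finset.mem_range.1 hi))
  gcongr

theorem Ninfty_eq (d : ℕ) : Ninfty d = ((d / 2 * ((d + 1) / 2) : ℕ) : ℝ) / (2 * d) := by
  have h1 : ⌊(d : ℝ) / 2⌋₊ = d / 2 := by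
    simpa using Nat.floor_div_natCast (d : ℝ) 2
  have h2 : ⌈(d : ℝ) / 2⌉₊ = (d + 1) / 2 := by
    refine le_antisymm (Nat.ceil_le.2 ?_) ?_
    · have : (d : ℝ) ≤ ((d + 1) / 2 * 2 : ℕ) := Nat.cast_le.2 (by omega)
      push_cast at this
      linarith
    · have h := Nat.le_ceil ((d : ℝ) / 2)
      have : (d : ℝ) ≤ (⌈(d : ℝ) / 2⌉₊ * 2 : ℕ) := by push_cast; linarith
      have := Nat.cast_le.1 this
      omega
  rw [Ninfty, h1, h2]; push_cast; ring

theorem mul_sub_le_half_mul_half (d j l : ℕ) (h : j + l = d) :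
    j * l ≤ d / 2 * ((d + 1) / 2) := by
  subst h
  obtain ⟨a, ha | ha⟩ := Nat.even_or_odd' (j + l)
  · have h1 : (j + l) / 2 = a := by omega
    have h2 : (j + l + 1) / 2 = a := by omega
    rw [h1, h2]
    zify at *
    nlinarith [sq_nonneg ((j : ℤ) - l)]
  · have h1 : (j + l) / 2 = a := by omega
    have h2 : (j + l + 1) / 2 = a + 1 := by omega
    rw [h1, h2]
    rcases le_or_gt j a with h | h
    · zify at *; nlinarith [mul_nonneg (sub_nonneg.2 h) (show (0 : ℤ) ≤ a + 1 - j by omega)]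
    · zify at *
      nlinarith [mul_nonneg (show (0 : ℤ) ≤ j - a - 1 by omega) (show (0 : ℤ) ≤ j - a by omega)]

/-- The left side is the gap between curve and polygon for the model sequence `i ^ 2 / 2`, whose
second differences are 1. With `θ = d * u - j`, multiplied by `2 * d` it is an interpolation between
`j (d - j)` and `(j + 1) (d - j - 1)` minus a nonnegative term, and both products are at most `⌊d/2⌋
⌈d/2⌉`. -/
theorem gap_sq_le_Ninfty {d j : ℕ} (hj : j < d) {u : ℝ}
    (hx : (d : ℝ) * u ∈ Icc (j : ℝ) (j + 1)) :
    (d * (d - 1) * u ^ 2 + d * u - (j ^ 2 + (d * u - j) * ((j + 1) ^ 2 - j ^ 2))) / 2 ≤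
      Ninfty d := by
  have hd : (0 : ℝ) < d := by exact_mod_cast (by omega : 0 < d)
  have hd1 : (1 : ℝ) ≤ d := by exact_mod_cast (by omega : 1 ≤ d)
  rw [Ninfty_eq]
  have h1 : (j : ℝ) * (d - j) ≤ ((d / 2 * ((d + 1) / 2) : ℕ) : ℝ) := by
    rw [← Nat.cast_sub hj.le, ← Nat.cast_mul]
    exact_mod_cast mul_sub_le_half_mul_half d j (d - j) (by omega)
  have h2 : ((j : ℝ) + 1) * (d - (j + 1)) ≤ ((d / 2 * ((d + 1) / 2) : ℕ) : ℝ) := by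
    rw [← Nat.cast_add_one, ← Nat.cast_sub hj, ← Nat.cast_mul]
    exact_mod_cast mul_sub_le_half_mul_half d (j + 1) (d - (j + 1)) (by omega)
  rw [le_div_iff₀ (by positivity)]
  generalize ((d / 2 * ((d + 1) / 2) : ℕ) : ℝ) = K at *
  obtain ⟨θ, hθ⟩ : ∃ θ, θ = d * u - j := ⟨_, rfl⟩
  have hu : (d : ℝ) * u = j + θ := by rw [hθ]; ring
  have h3 : 0 ≤ θ := by linarith [hx.1]
  have h4 : 0 ≤ 1 - θ := by linarith [hx.2]
  have e : (d * (d - 1) * u ^ 2 + d * u - (j ^ 2 + (d * u - j) * ((j + 1) ^ 2 - j ^ 2))) / 2 *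
      (2 * d) = (1 - θ) * (j * (d - j)) + θ * ((j + 1) * (d - (j + 1))) -
        (d - 1) * (θ * (1 - θ)) := by
    have : (d * (d - 1) * u ^ 2 + d * u - (j ^ 2 + (d * u - j) * ((j + 1) ^ 2 - j ^ 2))) / 2 *
      (2 * d) = (d - 1) * (d * u) ^ 2 + d * (d * u) -
        d * (j ^ 2 + (d * u - j) * ((j + 1) ^ 2 - j ^ 2)) := by ring
    rw [this, hu]; ring
  rw [e]
  have h5 : 0 ≤ (d - 1 : ℝ) * (θ * (1 - θ)) :=
    mul_nonneg (by linarith) (mul_nonneg h3 h4)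
  have h6 := mul_le_mul_of_nonneg_left h1 h4
  have h7 := mul_le_mul_of_nonneg_left h2 h3
  linarith

/-- Comparison with the model: `δ / 2 * i ^ 2 ± b i` are convex sequences, so their gaps are
nonnegative. Thus the gap of `b` is at most `δ` times the model gap in absolute value. -/
theorem abs_sum_bernstein_sub_line_le {d j : ℕ} (hj : j < d) {b : ℕ → ℝ} {δ : ℝ}
    (hb : ∀ i, i + 2 ≤ d → |b i - 2 * b (i + 1) + b (i + 2)| ≤ δ) (hδ : 0 ≤ δ)
    {u : ℝ} (hu : u ∈ Icc (0 : ℝ) 1) (hx : (d : ℝ) * u ∈ Icc (j : ℝ) (j + 1)) :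
    |∑ i ∈ Finset.range (d + 1), (d.choose i : ℝ) * u ^ i * (1 - u) ^ (d - i) * b i -
      (b j + (d * u - j) * (b (j + 1) - b j))| ≤ δ * Ninfty d := by
  have key : ∀ ε : ℝ, |ε| = 1 → -(ε * (∑ i ∈ Finset.range (d + 1),
      (d.choose i : ℝ) * u ^ i * (1 - u) ^ (d - i) * b i -
      (b j + (d * u - j) * (b (j + 1) - b j)))) ≤ δ * Ninfty d := by
    intro ε hε
    have h1 := line_le_sum_bernstein (c := fun i => δ / 2 * (i : ℝ) ^ 2 + ε * b i) hj
      (fun i hi => by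
        have h2 := hb i hi
        have h3 : |ε * (b i - 2 * b (i + 1) + b (i + 2))| ≤ δ := by rwa [abs_mul, hε, one_mul]
        have := neg_le_of_abs_le h3
        push_cast
        linarith) hu
    have e : ∑ i ∈ Finset.range (d + 1), (d.choose i : ℝ) * u ^ i * (1 - u) ^ (d - i) *
        (δ / 2 * (i : ℝ) ^ 2 + ε * b i) = δ / 2 * (d * (d - 1) * u ^ 2 + d * u) +
        ε * ∑ i ∈ Finset.range (d + 1), (d.choose i : ℝ) * u ^ i * (1 - u) ^ (d - i) * b i := by
      rw [← sum_bernstein_mul_sq, Finset.mul_sum, Finset.mul_sum, ← Finset.sum_add_distrib]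
      exact Finset.sum_congr rfl fun i _ => by ring
    rw [e] at h1
    have h2 := mul_le_mul_of_nonneg_left (gap_sq_le_Ninfty hj hx) hδ
    push_cast at h1
    linarith
  rw [abs_le]
  constructor
  · linarith [key 1 (by norm_num)]
  · linarith [key (-1) (by norm_num)]

/-- A Bézier curve is close to its uniformly parametrized control polygon. -/
theorem norm_bezier_sub_line_le {d j : ℕ} (hj : j < d) {q : ℕ → E3} {δ : E3}
    (hq : ∀ i, i + 2 ≤ d → ∀ c, |q i c - 2 * q (i + 1) c + q (i + 2) c| ≤ δ c)
    (hδ : ∀ c, 0 ≤ δ c) {u : ℝ} (hu : u ∈ Icc (0 : ℝ) 1)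
    (hx : (d : ℝ) * u ∈ Icc (j : ℝ) (j + 1)) :
    ‖bezier d q u - (q j + (d * u - j : ℝ) • (q (j + 1) - q j))‖ ≤ Ninfty d * ‖δ‖ := by
  have hN : 0 ≤ Ninfty d := by rw [Ninfty_eq]; positivity
  have h : ∀ c, |(bezier d q u - (q j + (d * u - j : ℝ) • (q (j + 1) - q j))) c| ≤
      |(Ninfty d • δ) c| := by
    intro c
    have h1 := abs_sum_bernstein_sub_line_le hj (fun i hi => hq i hi c) (hδ c) hu hx
    have h2 : 0 ≤ Ninfty d * δ c := mul_nonneg hN (hδ c)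
    simp only [PiLp.smul_apply, smul_eq_mul, abs_of_nonneg h2]
    rw [mul_comm (Ninfty d)]
    refine le_trans (le_of_eq ?_) h1
    simp [bezier]
  rw [← abs_of_nonneg hN, ← Real.norm_eq_abs, ← norm_smul, EuclideanSpace.norm_eq,
    EuclideanSpace.norm_eq]
  refine Real.sqrt_le_sqrt (Finset.sum_le_sum fun c _ => ?_)
  exact pow_le_pow_left₀ (norm_nonneg _) (h c) 2

/-- The vertex `j` of a control polygon is close to the point with parameter `j / d`. -/
theorem norm_bezier_sub_vertex_le {d j : ℕ} (hj : j ≤ d) (hd : 0 < d) {q : ℕ → E3} {δ : E3}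
    (hq : ∀ i, i + 2 ≤ d → ∀ c, |q i c - 2 * q (i + 1) c + q (i + 2) c| ≤ δ c)
    (hδ : ∀ c, 0 ≤ δ c) : ‖bezier d q (j / d) - q j‖ ≤ Ninfty d * ‖δ‖ := by
  have hd' : (0 : ℝ) < d := by exact_mod_cast hd
  have hu : (j / d : ℝ) ∈ Icc (0 : ℝ) 1 :=
    ⟨by positivity, by rw [div_le_one hd']; exact_mod_cast hj⟩
  have e : (d : ℝ) * (j / d) = j := by field_simp
  rcases hj.lt_or_eq with h | rfl
  · have := norm_bezier_sub_line_le h hq hδ hu (by rw [e]; simp)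
    rwa [e, sub_self, zero_smul, add_zero] at this
  -- The last vertex starts no edge; it is reached as the right end of the last one.
  · obtain ⟨l, rfl⟩ := Nat.exists_eq_succ_of_ne_zero hd.ne'
    have := norm_bezier_sub_line_le (Nat.lt_succ_self l) hq hδ hu (by rw [e]; simp)
    rw [e] at this
    simpa using this

/-! ### Ambient isotopies along normal fields in the pipe -/

open Topology Filter

/-- A continuous map from a compact set to a Hausdorff space is closed, hence a quotient map onto
its image. This gives continuity of functions defined only through a parametrization. -/
theorem continuousOn_image_of_comp {Z X W : Type*} [TopologicalSpace Z] [TopologicalSpace X]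
    [TopologicalSpace W] [T2Space X] {K : Set Z} (hK : IsCompact K) {π : Z → X}
    (hπ : ContinuousOn π K) {F : X → W} (hF : ContinuousOn (F ∘ π) K) :
    ContinuousOn F (π '' K) := by
  rw [continuousOn_iff_isClosed]
  intro C hC
  obtain ⟨D, hD, e⟩ := continuousOn_iff_isClosed.1 hF C hC
  refine ⟨π '' (D ∩ K), ?_, ?_⟩
  · exact ((hK.inter_left hD).image_of_continuousOn (hπ.mono inter_subset_right)).isClosed
  · ext x
    constructor
    · rintro ⟨hx, z, hz, rfl⟩
      exact ⟨⟨z, e ▸ ⟨hx, hz⟩, rfl⟩, z, hz, rfl⟩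
    · rintro ⟨⟨z, hz, rfl⟩, -⟩
      have : z ∈ F ∘ π ⁻¹' C ∩ K := e.symm ▸ hz
      exact ⟨this.1, z, this.2, rfl⟩

/-- A continuous field of short normal vectors, vanishing at the two ends, along a simple regular
curve with a non-self-intersecting pipe surface of radius `r`. -/
structure ShortNormalField (B w : ℝ → E3) (r : ℝ) : Prop where
  contDiffOn : ContDiffOn ℝ 1 B (Icc 0 1)
  regular : IsRegularCurve B
  simple : IsSimpleCurve B
  pos : 0 < r
  pipe : PipeNonSelfIntersecting B r
  continuousOn : ContinuousOn w (Icc 0 1)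
  normal : ∀ t ∈ Icc (0 : ℝ) 1, inner ℝ (w t) (velocity B t) = 0
  norm_le : ∀ t ∈ Icc (0 : ℝ) 1, ‖w t‖ ≤ r / 2
  zero : w 0 = 0
  one : w 1 = 0

open Classical in
/-- The displacement of a point of the pipe along the normal disc it lies on. -/
noncomputable def displacement (B w : ℝ → E3) (r : ℝ) (x : E3) : E3 :=
  if h : ∃ t ∈ Icc (0 : ℝ) 1, x ∈ normalDisc B r t then (1 - dist x (B h.choose) / r) • w h.choose
  else 0

/-- The solid pipe. -/
def solidPipe (B : ℝ → E3) (r : ℝ) : Set E3 := {x | ∃ t ∈ Icc (0 : ℝ) 1, x ∈ normalDisc B r t}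

theorem displacement_of_notMem {B w : ℝ → E3} {r : ℝ} {x : E3} (hx : x ∉ solidPipe B r) :
    displacement B w r x = 0 := dif_neg hx

theorem continuousOn_velocity {B : ℝ → E3} (h : ContDiffOn ℝ 1 B (Icc 0 1)) :
    ContinuousOn (velocity B) (Icc 0 1) :=
  h.continuousOn_derivWithin (uniqueDiffOn_Icc zero_lt_one) le_rfl

theorem hasDerivWithinAt_velocity {B : ℝ → E3} (h : ContDiffOn ℝ 1 B (Icc 0 1)) {t : ℝ}
    (ht : t ∈ Icc (0 : ℝ) 1) : HasDerivWithinAt B (velocity B t) (Icc 0 1) t :=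
  (h.differentiableOn (by norm_num) t ht).hasDerivWithinAt

/-- A normal plane at a point near `B t₀` separates it from `B t₀`. -/
theorem eventually_inner_velocity_pos {B : ℝ → E3} (hB : ContDiffOn ℝ 1 B (Icc 0 1))
    (hreg : IsRegularCurve B) {t₀ : ℝ} (ht₀ : t₀ ∈ Ioo (0 : ℝ) 1) :
    ∀ᶠ t in 𝓝[≠] t₀, 0 < (t₀ - t) * inner ℝ (B t₀ - B t) (velocity B t) := by
  have hI := Icc_mem_nhds ht₀.1 ht₀.2
  have hmem := Ioo_subset_Icc_self ht₀
  have h1 : Tendsto (slope B t₀) (𝓝[≠] t₀) (𝓝 (velocity B t₀)) :=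
    hasDerivAt_iff_tendsto_slope.1 ((hasDerivWithinAt_velocity hB hmem).hasDerivAt hI)
  have h2 : Tendsto (velocity B) (𝓝[≠] t₀) (𝓝 (velocity B t₀)) :=
    ((continuousOn_velocity hB).continuousAt hI).mono_left nhdsWithin_le_nhds
  -- The difference quotient and the nearby velocities both tend to the velocity at `t₀`, so their
  -- inner product tends to its squared norm.
  have h3 := h1.inner (𝕜 := ℝ) h2
  have h4 : (0 : ℝ) < inner ℝ (velocity B t₀) (velocity B t₀) :=
    real_inner_self_pos.2 (hreg t₀ hmem)
  filter_upwards [h3.eventually_const_lt h4, self_mem_nhdsWithin] with t ht hne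
  rw [slope_def_module, real_inner_smul_left] at ht
  have hne' : t - t₀ ≠ 0 := sub_ne_zero.2 hne
  have h5 : 0 < (t - t₀) ^ 2 := by positivity
  have h6 := mul_pos h5 ht
  have e : (t - t₀) ^ 2 * ((t - t₀)⁻¹ * inner ℝ (B t - B t₀) (velocity B t)) =
      (t₀ - t) * inner ℝ (B t₀ - B t) (velocity B t) := by
    rw [← neg_sub (B t) (B t₀), inner_neg_left]
    field_simp
    ring
  rwa [e] at h6

namespace ShortNormalField
variable {B w : ℝ → E3} {r : ℝ}

/-- Two different parameters can share a disc point only if they are the two ends of a closed curve,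
where the field vanishes. The choice of parameter in `displacement` is therefore harmless. -/
theorem eq_or_zero (h : ShortNormalField B w r) {s t : ℝ} {x : E3} (hs : s ∈ Icc (0 : ℝ) 1)
    (ht : t ∈ Icc (0 : ℝ) 1) (hxs : x ∈ normalDisc B r s) (hxt : x ∈ normalDisc B r t) :
    s = t ∨ (w s = 0 ∧ w t = 0) := by
  have hB : B s = B t := by
    by_contra hne
    exact disjoint_left.1 (h.pipe s hs t ht hne) hxs hxt
  rcases lt_trichotomy s t with hlt | heq | hlt
  · obtain ⟨rfl, rfl⟩ := h.simple s hs t ht hlt hB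
    exact Or.inr ⟨h.zero, h.one⟩
  · exact Or.inl heq
  · obtain ⟨rfl, rfl⟩ := h.simple t ht s hs hlt hB.symm
    exact Or.inr ⟨h.one, h.zero⟩

theorem displacement_eq (h : ShortNormalField B w r) {t : ℝ} {x : E3} (ht : t ∈ Icc (0 : ℝ) 1)
    (hx : x ∈ normalDisc B r t) : displacement B w r x = (1 - dist x (B t) / r) • w t := by
  have hex : ∃ t ∈ Icc (0 : ℝ) 1, x ∈ normalDisc B r t := ⟨t, ht, hx⟩
  rw [displacement, dif_pos hex]
  rcases h.eq_or_zero hex.choose_spec.1 ht hex.choose_spec.2 hx with e | ⟨e1, e2⟩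
  · rw [e]
  · rw [e1, e2, smul_zero, smul_zero]

/-- For `t` on either side of `t₀`, the normal plane at `t` has `B t₀` strictly on a known side. The
point `x` lies on the same side, since otherwise the segment from `B t₀` to `x` would cross that
plane inside both discs. So `inner (y - B t) (velocity B t)` changes sign between `t₀ - η / 2` and
`t₀ + η / 2` at `y = x`, hence also for `y` near `x`, and a zero in between gives a disc containing
`y`. -/
theorem solidPipe_mem_nhds (h : ShortNormalField B w r) {t₀ : ℝ} {x : E3} (ht₀ : t₀ ∈ Ioo (0 : ℝ) 1)
    (hx : x ∈ normalDisc B r t₀) (hlt : dist x (B t₀) < r) : solidPipe B r ∈ 𝓝 x := by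
  have hI := Icc_mem_nhds ht₀.1 ht₀.2
  have hmem := Ioo_subset_Icc_self ht₀
  -- Half of the slack `r - dist x (B t₀)`: it is spent once on moving the centre and once on moving
  -- the point.
  obtain ⟨ε, hε⟩ : ∃ ε, ε = (r - dist x (B t₀)) / 2 := ⟨_, rfl⟩
  have hε0 : 0 < ε := by rw [hε]; linarith
  have hcont : ContinuousAt B t₀ := h.contDiffOn.continuousOn.continuousAt hI
  have hev : ∀ᶠ t in 𝓝 t₀, t ∈ Ioo (0 : ℝ) 1 ∧ dist (B t) (B t₀) < ε ∧
      (t ≠ t₀ → 0 < (t₀ - t) * inner ℝ (B t₀ - B t) (velocity B t)) :=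
    (show ∀ᶠ t in 𝓝 t₀, t ∈ Ioo (0 : ℝ) 1 from Ioo_mem_nhds ht₀.1 ht₀.2).and ((Metric.tendsto_nhds.1 hcont ε hε0).and
      (eventually_nhdsWithin_iff.1 (eventually_inner_velocity_pos h.contDiffOn h.regular ht₀)))
  obtain ⟨η, hη, hball⟩ := Metric.eventually_nhds_iff.1 hev
  have hclose : ∀ t, t ∈ Icc (t₀ - η / 2) (t₀ + η / 2) → dist t t₀ < η := by
    intro t ht
    rw [Real.dist_eq, abs_lt]
    constructor <;> linarith [ht.1, ht.2]
  have hsign : ∀ t, t ∈ Icc (t₀ - η / 2) (t₀ + η / 2) → t ≠ t₀ →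
      0 < (t₀ - t) * inner ℝ (x - B t) (velocity B t) := by
    intro t ht hne
    obtain ⟨htI, htd, hpos⟩ := hball (hclose t ht)
    have hpos := hpos hne
    by_contra! hle
    obtain ⟨a, ha⟩ : ∃ a, a = (t₀ - t) * inner ℝ (B t₀ - B t) (velocity B t) := ⟨_, rfl⟩
    obtain ⟨b, hb⟩ : ∃ b, b = (t₀ - t) * inner ℝ (x - B t) (velocity B t) := ⟨_, rfl⟩
    rw [← ha] at hpos
    rw [← hb] at hle
    have hab : 0 < a - b := by linarith
    -- The position at which the segment from `B t₀` to `x` crosses the normal plane at `t`.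
    obtain ⟨l, hl⟩ : ∃ l, l = a / (a - b) := ⟨_, rfl⟩
    have hl0 : 0 ≤ l := by rw [hl]; positivity
    have hl1 : l ≤ 1 := by rw [hl, div_le_one hab]; linarith
    have hl2 : l * (a - b) = a := by rw [hl]; field_simp
    obtain ⟨y, hy⟩ : ∃ y, y = B t₀ + l • (x - B t₀) := ⟨_, rfl⟩
    have hyd : dist y (B t₀) ≤ dist x (B t₀) := by
      rw [hy, dist_eq_norm, dist_eq_norm, add_sub_cancel_left, norm_smul, Real.norm_eq_abs,
        abs_of_nonneg hl0]
      exact mul_le_of_le_one_left (norm_nonneg _) hl1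
    have hy0 : y ∈ normalDisc B r t₀ := by
      refine ⟨?_, hyd.trans hlt.le⟩
      rw [hy, add_sub_cancel_left, real_inner_smul_left, hx.1, mul_zero]
    have hyt : y ∈ normalDisc B r t := by
      constructor
      · have e : y - B t = (1 - l) • (B t₀ - B t) + l • (x - B t) := by rw [hy]; module
        have h0 : (t₀ - t) * inner ℝ (y - B t) (velocity B t) = 0 := by
          rw [e, inner_add_left, real_inner_smul_left, real_inner_smul_left]
          linear_combination (-(1 - l)) * ha - l * hb - hl2
        exact (mul_eq_zero.1 h0).resolve_left (sub_ne_zero.2 hne.symm)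
      · have := dist_triangle y (B t₀) (B t)
        rw [dist_comm (B t₀)] at this
        linarith
    have hBne : B t ≠ B t₀ := by
      intro heq
      rcases lt_or_gt_of_ne hne with hl | hl
      · exact htI.1.ne' (h.simple t (Ioo_subset_Icc_self htI) t₀ hmem hl heq).1
      · exact ht₀.1.ne' (h.simple t₀ hmem t (Ioo_subset_Icc_self htI) hl heq.symm).1
    exact disjoint_left.1 (h.pipe t (Ioo_subset_Icc_self htI) t₀ hmem hBne) hyt hy0
  have hcontg : ∀ t, Continuous fun y : E3 => inner ℝ (y - B t) (velocity B t) :=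
    fun t => (continuous_id.sub continuous_const).inner continuous_const
  have ha := hsign (t₀ - η / 2) (by constructor <;> linarith) (by linarith)
  have hb := hsign (t₀ + η / 2) (by constructor <;> linarith) (by linarith)
  have ha' : 0 < inner ℝ (x - B (t₀ - η / 2)) (velocity B (t₀ - η / 2)) :=
    (mul_pos_iff_of_pos_left (by linarith)).1 ha
  have hb' : inner ℝ (x - B (t₀ + η / 2)) (velocity B (t₀ + η / 2)) < 0 := by
    by_contra! hc
    exact absurd hb (not_lt.2 (mul_nonpos_of_nonpos_of_nonneg (by linarith) hc))
  filter_upwards [(hcontg _).continuousAt.eventually_const_lt ha',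
    (hcontg _).continuousAt.eventually_lt_const hb', Metric.ball_mem_nhds x hε0] with y hy1 hy2 hy3
  have hsub : Icc (t₀ - η / 2) (t₀ + η / 2) ⊆ Icc 0 1 := fun t ht =>
    Ioo_subset_Icc_self (hball (hclose t ht)).1
  have hcg : ContinuousOn (fun t => inner ℝ (y - B t) (velocity B t))
      (Icc (t₀ - η / 2) (t₀ + η / 2)) :=
    ((continuousOn_const.sub h.contDiffOn.continuousOn).inner
      (continuousOn_velocity h.contDiffOn)).mono hsub
  obtain ⟨t, ht, ht0⟩ := intermediate_value_Icc' (by linarith) hcg ⟨hy2.le, hy1.le⟩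
  refine ⟨t, hsub ht, ht0, ?_⟩
  have h1 := (hball (hclose t ht)).2.1
  have h2 := dist_triangle4 y x (B t₀) (B t)
  rw [dist_comm (B t₀)] at h2
  have h3 : dist y x < ε := hy3
  linarith

/-- Two closed sets are pasted: the solid pipe, a compact image of the bundle of normal discs, and
the closure of its complement. On the latter the displacement is zero, since a pipe point outside
the interior lies on the rim of its disc, where the factor vanishes, or in an end disc, where `w`
vanishes. -/
theorem continuous_displacement (h : ShortNormalField B w r) :
    Continuous (displacement B w r) := by
  obtain ⟨K, hKdef⟩ : ∃ K : Set (E3 × ℝ), K = {z ∈ Metric.closedBall (0 : E3) r ×ˢ Icc (0 : ℝ) 1 |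
    inner ℝ z.1 (velocity B z.2) = 0} := ⟨_, rfl⟩
  have hprod : IsCompact (Metric.closedBall (0 : E3) r ×ˢ Icc (0 : ℝ) 1) :=
    (isCompact_closedBall _ _).prod isCompact_Icc
  have hsnd : MapsTo Prod.snd (Metric.closedBall (0 : E3) r ×ˢ Icc (0 : ℝ) 1) (Icc 0 1) :=
    fun z hz => hz.2
  have hK : IsCompact K := by
    have h1 : ContinuousOn (fun z : E3 × ℝ => inner ℝ z.1 (velocity B z.2))
        (Metric.closedBall (0 : E3) r ×ˢ Icc (0 : ℝ) 1) :=
      continuousOn_fst.inner ((continuousOn_velocity h.contDiffOn).comp continuousOn_snd hsnd)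
    have h2 := h1.preimage_isClosed_of_isClosed hprod.isClosed (isClosed_singleton (x := (0 : ℝ)))
    rw [hKdef]
    exact hprod.of_isClosed_subset h2 fun z hz => hz.1
  have hKsub : K ⊆ Metric.closedBall (0 : E3) r ×ˢ Icc (0 : ℝ) 1 := by
    rw [hKdef]; exact fun z hz => hz.1
  have hπ : ContinuousOn (fun z : E3 × ℝ => B z.2 + z.1) K :=
    ((h.contDiffOn.continuousOn.comp continuousOn_snd hsnd).add continuousOn_fst).mono hKsub
  have hdisc : ∀ z ∈ K, B z.2 + z.1 ∈ normalDisc B r z.2 := by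
    rw [hKdef]
    rintro z ⟨hz1, hz2⟩
    refine ⟨by simpa using hz2, ?_⟩
    rw [dist_eq_norm, add_sub_cancel_left]
    simpa using hz1.1
  have himage : (fun z : E3 × ℝ => B z.2 + z.1) '' K = solidPipe B r := by
    ext x
    constructor
    · rintro ⟨z, hz, rfl⟩
      exact ⟨z.2, (hKsub hz).2, hdisc z hz⟩
    · rintro ⟨t, ht, hx⟩
      refine ⟨(x - B t, t), ?_, by simp⟩
      rw [hKdef]
      refine ⟨⟨?_, ht⟩, hx.1⟩
      rw [mem_closedBall_zero_iff, ← dist_eq_norm]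
      exact hx.2
  have hF : ContinuousOn (displacement B w r ∘ fun z : E3 × ℝ => B z.2 + z.1) K := by
    have h1 : ContinuousOn (fun z : E3 × ℝ => (1 - ‖z.1‖ / r) • w z.2) K :=
      ContinuousOn.smul (continuous_const.sub (continuous_fst.norm.div_const r)).continuousOn ((h.continuousOn.comp continuousOn_snd hsnd).mono hKsub)
    refine h1.congr fun z hz => ?_
    change displacement B w r (B z.2 + z.1) = _
    rw [h.displacement_eq (hKsub hz).2 (hdisc z hz), dist_eq_norm, add_sub_cancel_left]
  have hT := continuousOn_image_of_comp hK hπ hF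
  have hclosed := (hK.image_of_continuousOn hπ).isClosed
  rw [himage] at hT hclosed
  have hzero : ContinuousOn (displacement B w r) (closure (solidPipe B r)ᶜ) := by
    refine (continuousOn_const (c := (0 : E3))).congr fun x hx => ?_
    by_cases hxT : x ∈ solidPipe B r
    · obtain ⟨t, ht, hxt⟩ := hxT
      rw [h.displacement_eq ht hxt]
      by_cases hlt : dist x (B t) < r
      · rcases ht.1.eq_or_lt with rfl | h0
        · rw [h.zero, smul_zero]
        rcases ht.2.eq_or_lt with rfl | h1
        · rw [h.one, smul_zero]
        rw [closure_compl] at hx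
        exact absurd (mem_interior_iff_mem_nhds.2 (h.solidPipe_mem_nhds ⟨h0, h1⟩ hxt hlt)) hx
      · have : dist x (B t) = r := le_antisymm hxt.2 (not_lt.1 hlt)
        rw [this, div_self h.pos.ne', sub_self, zero_smul]
    · exact displacement_of_notMem hxT
  have hunion := hT.union_of_isClosed hzero hclosed isClosed_closure
  have huniv : solidPipe B r ∪ closure (solidPipe B r)ᶜ = univ :=
    eq_univ_of_forall fun x => (em (x ∈ solidPipe B r)).imp id fun hx => subset_closure hx
  rwa [huniv, continuousOn_univ] at hunion

theorem add_smul_displacement_mem (h : ShortNormalField B w r) {t s : ℝ} {x : E3}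
    (ht : t ∈ Icc (0 : ℝ) 1) (hs : s ∈ Icc (0 : ℝ) 1) (hx : x ∈ normalDisc B r t) :
    x + s • displacement B w r x ∈ normalDisc B r t := by
  have hr := h.pos
  have e : x + s • displacement B w r x - B t =
      (x - B t) + (s * (1 - dist x (B t) / r)) • w t := by
    rw [h.displacement_eq ht hx]; module
  have h0 : 0 ≤ 1 - dist x (B t) / r := by
    rw [sub_nonneg, div_le_one hr]; exact hx.2
  constructor
  · rw [e, inner_add_left, real_inner_smul_left, hx.1, h.normal t ht]; ring
  · rw [dist_eq_norm, e]
    calc ‖(x - B t) + (s * (1 - dist x (B t) / r)) • w t‖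
        ≤ ‖x - B t‖ + s * (1 - dist x (B t) / r) * ‖w t‖ := by
          refine (norm_add_le _ _).trans_eq ?_
          rw [norm_smul, Real.norm_eq_abs, abs_of_nonneg (mul_nonneg hs.1 h0)]
      _ ≤ dist x (B t) + 1 * (1 - dist x (B t) / r) * r := by
          rw [← dist_eq_norm]
          have h1 := h.norm_le t ht
          have h2 : ‖w t‖ ≤ r := by linarith
          have h3 := hs.2
          gcongr
      _ = r := by field_simp; ring

/-- Each disc is mapped into itself, so it suffices to argue disc by disc. There the displacement is
Lipschitz with constant `1 / 2`, by `‖w t‖ ≤ r / 2`, which gives injectivity; as it is parallel to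
`w t`, a preimage is found by solving one scalar equation. -/
theorem bijective_add_smul_displacement (h : ShortNormalField B w r) {s : ℝ}
    (hs : s ∈ Icc (0 : ℝ) 1) : Function.Bijective fun x => x + s • displacement B w r x := by
  have hr := h.pos
  have hout : ∀ x, x ∉ solidPipe B r → x + s • displacement B w r x = x := fun x hx => by
    rw [displacement_of_notMem hx, smul_zero, add_zero]
  have hin : ∀ x, x ∈ solidPipe B r → x + s • displacement B w r x ∈ solidPipe B r :=
    fun x ⟨t, ht, hx⟩ => ⟨t, ht, h.add_smul_displacement_mem ht hs hx⟩
  constructor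
  · intro x y hxy
    change x + s • displacement B w r x = y + s • displacement B w r y at hxy
    by_cases hx : x ∈ solidPipe B r
    · by_cases hy : y ∈ solidPipe B r
      · obtain ⟨t, ht, hxt⟩ := hx
        obtain ⟨t', ht', hyt'⟩ := hy
        have h1 := h.add_smul_displacement_mem ht hs hxt
        have h2 := h.add_smul_displacement_mem ht' hs hyt'
        rw [hxy] at h1
        rw [h.displacement_eq ht hxt, h.displacement_eq ht' hyt'] at hxy
        rcases h.eq_or_zero ht ht' h1 h2 with rfl | ⟨e1, e2⟩
        · have e : x - y = (s * ((dist x (B t) - dist y (B t)) / r)) • w t := by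
            rw [← sub_eq_zero] at hxy ⊢
            rw [← hxy]; module
          have h3 : ‖x - y‖ ≤ ‖x - y‖ / 2 := by
            calc ‖x - y‖ = s * (|dist x (B t) - dist y (B t)| / r) * ‖w t‖ := by
                  rw [e, norm_smul, Real.norm_eq_abs, abs_mul, abs_div, abs_of_nonneg hs.1,
                    abs_of_pos hr]
              _ ≤ 1 * (‖x - y‖ / r) * (r / 2) := by
                  have h4 := h.norm_le t ht
                  have h5 := abs_dist_sub_le x y (B t)
                  rw [dist_eq_norm x y] at h5
                  have h6 := hs.2
                  gcongr
              _ = ‖x - y‖ / 2 := by field_simp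
          have h4 : ‖x - y‖ = 0 := le_antisymm (by linarith) (norm_nonneg _)
          exact sub_eq_zero.1 (norm_eq_zero.1 h4)
        · simpa [e1, e2] using hxy
      · rw [hout y hy] at hxy
        exact absurd (hxy ▸ hin x hx) hy
    · by_cases hy : y ∈ solidPipe B r
      · rw [hout x hx] at hxy
        exact absurd (hxy ▸ hin y hy) hx
      · rwa [hout x hx, hout y hy] at hxy
  · intro y
    by_cases hy : y ∈ solidPipe B r
    · obtain ⟨t, ht, hyt⟩ := hy
      -- The preimage is sought as `y - c • w t`; the coefficient `c` solves a fixed-point equation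
      -- on `[0, s]` by the intermediate value theorem.
      have hcont : ContinuousOn (fun c : ℝ => c - s * (1 - dist (y - c • w t) (B t) / r))
          (Icc 0 s) := by fun_prop
      have h0 : (0 : ℝ) - s * (1 - dist (y - (0 : ℝ) • w t) (B t) / r) ≤ 0 := by
        have : 0 ≤ 1 - dist y (B t) / r := by
          rw [sub_nonneg, div_le_one hr]; exact hyt.2
        rw [zero_smul, sub_zero]
        linarith [mul_nonneg hs.1 this]
      have h1 : 0 ≤ s - s * (1 - dist (y - s • w t) (B t) / r) := by
        have : 0 ≤ dist (y - s • w t) (B t) / r := by positivity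
        linarith [mul_nonneg hs.1 this]
      obtain ⟨c, hc, hc0⟩ := intermediate_value_Icc hs.1 hcont ⟨h0, h1⟩
      have hc0 : c = s * (1 - dist (y - c • w t) (B t) / r) := sub_eq_zero.1 hc0
      have hx : y - c • w t ∈ normalDisc B r t := by
        constructor
        · rw [sub_right_comm, inner_sub_left, hyt.1, real_inner_smul_left, h.normal t ht]; ring
        · rcases hs.1.eq_or_lt with rfl | hs0
          · have : c = 0 := le_antisymm hc.2 hc.1
            rw [this, zero_smul, sub_zero]; exact hyt.2
          · by_contra! hlt
            have h2 : 1 < dist (y - c • w t) (B t) / r := by rwa [one_lt_div hr]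
            have h3 : s * (1 - dist (y - c • w t) (B t) / r) < 0 :=
              mul_neg_of_pos_of_neg hs0 (by linarith)
            linarith [hc.1]
      refine ⟨y - c • w t, ?_⟩
      change y - c • w t + s • displacement B w r (y - c • w t) = y
      rw [h.displacement_eq ht hx, smul_smul, ← hc0, sub_add_cancel]
    · exact ⟨y, hout y hy⟩

theorem norm_displacement_le (h : ShortNormalField B w r) (x : E3) :
    ‖displacement B w r x‖ ≤ r := by
  by_cases hx : x ∈ solidPipe B r
  · obtain ⟨t, ht, hxt⟩ := hx
    have hr := h.pos
    have h0 : 0 ≤ 1 - dist x (B t) / r := by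
      rw [sub_nonneg, div_le_one hr]; exact hxt.2
    have h1 : 1 - dist x (B t) / r ≤ 1 := by
      have : 0 ≤ dist x (B t) / r := by positivity
      linarith
    rw [h.displacement_eq ht hxt, norm_smul, Real.norm_eq_abs, abs_of_nonneg h0]
    have h2 := mul_le_mul h1 (h.norm_le t ht) (norm_nonneg _) zero_le_one
    linarith
  · rw [displacement_of_notMem hx, norm_zero]; exact h.pos.le

theorem exists_homeomorph (h : ShortNormalField B w r) (s : unitInterval) :
    ∃ e : E3 ≃ₜ E3, ∀ x, e x = x + (s : ℝ) • displacement B w r x := by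
  have hcont : Continuous fun x => x + (s : ℝ) • displacement B w r x := by
    have := h.continuous_displacement
    fun_prop
  -- A bounded displacement cannot bring points back from infinity. Proper maps are closed, so the
  -- continuous bijection is a homeomorphism.
  have hproper : IsProperMap fun x => x + (s : ℝ) • displacement B w r x := by
    refine isProperMap_iff_tendsto_cocompact.2 ⟨hcont, ?_⟩
    rw [← Metric.cobounded_eq_cocompact, ← comap_norm_atTop]
    refine tendsto_comap_iff.2 ?_
    refine tendsto_atTop_mono (f := fun x : E3 => ‖x‖ - r) (fun x => ?_)
      (tendsto_atTop_add_const_right _ _ tendsto_comap)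
    have h1 : ‖(s : ℝ) • displacement B w r x‖ ≤ r := by
      rw [norm_smul, Real.norm_eq_abs, abs_of_nonneg s.2.1]
      exact (mul_le_of_le_one_left (norm_nonneg _) s.2.2).trans (h.norm_displacement_le x)
    have h2 := norm_sub_norm_le x (-((s : ℝ) • displacement B w r x))
    rw [sub_neg_eq_add, norm_neg] at h2
    change _ ≤ ‖x + (s : ℝ) • displacement B w r x‖
    linarith
  exact ⟨(Equiv.ofBijective _ (h.bijective_add_smul_displacement s.2)).toHomeomorphOfContinuousClosed
    hcont hproper.isClosedMap, fun x => rfl⟩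

/-- Pushing a curve along a short normal field is an ambient isotopy. -/
theorem ambientIsotopic (h : ShortNormalField B w r) :
    AmbientIsotopic ((fun t => B t + w t) '' Icc 0 1) (B '' Icc 0 1) := by
  choose e he using h.exists_homeomorph
  have hB : ∀ t ∈ Icc (0 : ℝ) 1, e 1 (B t) = B t + w t := by
    intro t ht
    have hmem : B t ∈ normalDisc B r t := ⟨by simp, by simpa using h.pos.le⟩
    rw [he, h.displacement_eq ht hmem]
    simp
  -- The isotopy runs from the pushed curve back to the curve, as `e (1 - s) ∘ (e 1)⁻¹`. Only one
  -- fixed inverse occurs, so joint continuity needs no argument about inverses depending on `s`.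
  refine ⟨fun s => (e 1).symm.trans (e (unitInterval.symm s)), ?_, fun x => ?_, ?_⟩
  · have h1 : Continuous fun z : unitInterval × E3 => (e 1).symm z.2 :=
      (e 1).symm.continuous.comp continuous_snd
    have h2 : Continuous fun z : unitInterval × E3 => ((unitInterval.symm z.1 : unitInterval) : ℝ) :=
      continuous_subtype_val.comp (unitInterval.continuous_symm.comp continuous_fst)
    simp only [Homeomorph.trans_apply, he]
    exact h1.add (h2.smul (h.continuous_displacement.comp h1))
  · simp
  · have h0 : ∀ x, e 0 x = x := fun x => by simp [he]
    ext x
    simp only [unitInterval.symm_one, Homeomorph.trans_apply, h0, mem_image]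
    constructor
    · rintro ⟨_, ⟨t, ht, rfl⟩, rfl⟩
      exact ⟨t, ht, by rw [← hB t ht, Homeomorph.symm_apply_apply]⟩
    · rintro ⟨t, ht, rfl⟩
      exact ⟨_, ⟨t, ht, rfl⟩, by rw [← hB t ht, Homeomorph.symm_apply_apply]⟩

end ShortNormalField

/-! ### Paths near an arc as normal push-offs -/

theorem bezier_mem_of_convex {C : Set E3} (hC : Convex ℝ C) {n : ℕ} {q : ℕ → E3}
    (hq : ∀ j ≤ n, q j ∈ C) {u : ℝ} (hu : u ∈ Icc (0 : ℝ) 1) : bezier n q u ∈ C := by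
  refine hC.sum_mem (fun j _ => ?_) (sum_bernstein n u) fun j hj =>
    hq j (Nat.lt_succ_iff.1 (Finset.mem_range.1 hj))
  have h0 : 0 ≤ 1 - u := by linarith [hu.2]
  have h1 := hu.1
  positivity

theorem injOn_of_inner_velocity_pos {B : ℝ → E3} (hB : ContDiffOn ℝ 1 B (Icc 0 1)) {a b : ℝ}
    (hsub : Icc a b ⊆ Icc 0 1)
    (hvel : ∀ s ∈ Icc a b, ∀ t ∈ Icc a b, 0 < inner ℝ (velocity B s) (velocity B t)) :
    InjOn B (Icc a b) := by
  intro s hs t ht hst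
  have hmono : StrictMonoOn (fun y => inner ℝ (B y) (velocity B s)) (Icc a b) := by
    refine strictMonoOn_of_hasDerivWithinAt_pos (convex_Icc a b)
      (f' := fun y => inner ℝ (velocity B y) (velocity B s))
      ((hB.continuousOn.mono hsub).inner continuousOn_const) (fun y hy => ?_)
      fun y hy => hvel y (interior_subset hy) s hs
    have h1 := (hasDerivWithinAt_velocity hB (hsub (interior_subset hy))).mono
      (interior_subset.trans hsub)
    have h2 := h1.inner ℝ (hasDerivWithinAt_const y (interior (Icc a b)) (velocity B s))
    simpa using h2
  exact hmono.injOn hs ht (by simp only [hst])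

/-- The closest point of an arc is the centre of a normal disc, if neither of the normal planes at
the ends of the arc separates the given point from the arc. -/
theorem exists_mem_normalDisc {B : ℝ → E3} (hB : ContDiffOn ℝ 1 B (Icc 0 1)) {a b : ℝ}
    (hsub : Icc a b ⊆ Icc 0 1) {x : E3} (ha : 0 ≤ inner ℝ (x - B a) (velocity B a))
    (hb : inner ℝ (x - B b) (velocity B b) ≤ 0) {u ρ : ℝ} (hu : u ∈ Icc a b)
    (hx : dist x (B u) ≤ ρ) : ∃ t ∈ Icc a b, x ∈ normalDisc B ρ t := by
  have hcont : ContinuousOn (fun y => ‖x - B y‖ ^ 2) (Icc a b) :=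
    (continuousOn_const.sub (hB.continuousOn.mono hsub)).norm.pow 2
  obtain ⟨t, ht, hmin⟩ := isCompact_Icc.exists_isMinOn ⟨u, hu⟩ hcont
  have hder : HasDerivWithinAt (fun y => ‖x - B y‖ ^ 2)
      (2 * inner ℝ (x - B t) (-velocity B t)) (Icc a b) t :=
    (((hasDerivWithinAt_velocity hB (hsub ht)).mono hsub).const_sub x).norm_sq
  -- First-order condition at a minimum that may be an endpoint: the derivative is nonnegative in
  -- every direction pointing into the interval.
  have hfirst : ∀ y ∈ Icc a b, 0 ≤ (y - t) * -inner ℝ (x - B t) (velocity B t) := by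
    intro y hy
    have := hmin.localize.hasFDerivWithinAt_nonneg hder.hasFDerivWithinAt
      (sub_mem_posTangentConeAt_of_segment_subset ((convex_Icc a b).segment_subset ht hy))
    simp [inner_neg_right] at this
    linarith
  refine ⟨t, ht, ?_, ?_⟩
  · have hab : a ≤ b := ht.1.trans ht.2
    refine le_antisymm ?_ ?_
    · rcases ht.2.eq_or_lt with rfl | hlt
      · exact hb
      · by_contra! hc
        have := hfirst b ⟨hab, le_rfl⟩
        linarith [mul_pos (sub_pos.2 hlt) hc]
    · rcases ht.1.eq_or_lt with rfl | hlt
      · exact ha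
      · by_contra! hc
        have := hfirst a ⟨le_rfl, hab⟩
        linarith [mul_pos (sub_pos.2 hlt) (neg_pos.2 hc)]
  · have h1 : ‖x - B t‖ ^ 2 ≤ ‖x - B u‖ ^ 2 := hmin hu
    rw [dist_eq_norm] at hx ⊢
    exact (le_of_sq_le_sq h1 (norm_nonneg _)).trans hx

/-- A path near an arc, running in the direction of all the tangents of the arc, is obtained from
the arc by pushing it along a normal field. -/
theorem exists_normalField_of_path {B ℓ : ℝ → E3} {a b r : ℝ} (hB : ContDiffOn ℝ 1 B (Icc 0 1))
    (hr : 0 < r) (hpipe : PipeNonSelfIntersecting B r) (hab : a ≤ b) (hsub : Icc a b ⊆ Icc 0 1)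
    (hvel : ∀ s ∈ Icc a b, ∀ t ∈ Icc a b, 0 < inner ℝ (velocity B s) (velocity B t))
    (hcont : ContinuousOn ℓ (Icc a b))
    (hmono : ∀ t ∈ Icc a b, ∀ u ∈ Icc a b, ∀ v ∈ Icc a b, u < v →
      0 < inner ℝ (ℓ v - ℓ u) (velocity B t))
    (hℓa : ℓ a = B a) (hℓb : ℓ b = B b) (hdist : ∀ u ∈ Icc a b, dist (ℓ u) (B u) ≤ r / 2) :
    ∃ w : ℝ → E3, Continuous w ∧ (∀ t ∉ Ioo a b, w t = 0) ∧
      (∀ t ∈ Icc a b, inner ℝ (w t) (velocity B t) = 0) ∧ (∀ t ∈ Icc a b, ‖w t‖ ≤ r / 2) ∧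
      (fun t => B t + w t) '' Icc a b = ℓ '' Icc a b := by
  have ha : a ∈ Icc a b := ⟨le_rfl, hab⟩
  have hb : b ∈ Icc a b := ⟨hab, le_rfl⟩
  have hmono' : ∀ t ∈ Icc a b, ∀ u ∈ Icc a b, ∀ v ∈ Icc a b, u ≤ v →
      0 ≤ inner ℝ (ℓ v - ℓ u) (velocity B t) := by
    intro t ht u hu v hv huv
    rcases huv.eq_or_lt with rfl | h
    · simp
    · exact (hmono t ht u hu v hv h).le
  have hex : ∀ u ∈ Icc a b, ∃ t ∈ Icc a b, ℓ u ∈ normalDisc B (r / 2) t := by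
    intro u hu
    refine exists_mem_normalDisc hB hsub ?_ ?_ hu (hdist u hu)
    · rw [← hℓa]; exact hmono' a ha a ha u hu hu.1
    · have := hmono' b hb u hu b hb hu.2
      rw [← hℓb, ← neg_sub, inner_neg_left]
      linarith
  have huniq : ∀ x, ∀ s ∈ Icc a b, ∀ t ∈ Icc a b, x ∈ normalDisc B (r / 2) s →
      x ∈ normalDisc B (r / 2) t → s = t := by
    intro x s hs t ht hxs hxt
    refine injOn_of_inner_velocity_pos hB hsub hvel hs ht ?_
    by_contra hne
    exact disjoint_left.1 (hpipe s (hsub hs) t (hsub ht) hne)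
      ⟨hxs.1, hxs.2.trans (by linarith)⟩ ⟨hxt.1, hxt.2.trans (by linarith)⟩
  -- `T u` is the parameter of the normal disc through `ℓ u`. It will be shown to be a homeomorphism
  -- of `[a, b]`, and the field is `ℓ ∘ T⁻¹ - B`.
  choose! T hT hTdisc using hex
  -- By `huniq` the compact set `K` is the graph of `T`, and a function with compact graph is
  -- continuous.
  have hTcont : ContinuousOn T (Icc a b) := by
    obtain ⟨K, hK⟩ : ∃ K : Set (ℝ × ℝ),
      K = {z ∈ Icc a b ×ˢ Icc a b | ℓ z.1 ∈ normalDisc B (r / 2) z.2} := ⟨_, rfl⟩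
    have hprod : IsCompact (Icc a b ×ˢ Icc a b) := isCompact_Icc.prod isCompact_Icc
    have h1 : ContinuousOn (fun z : ℝ × ℝ => ℓ z.1) (Icc a b ×ˢ Icc a b) :=
      hcont.comp continuousOn_fst fun z hz => hz.1
    have h2 : ContinuousOn (fun z : ℝ × ℝ => B z.2) (Icc a b ×ˢ Icc a b) :=
      (hB.continuousOn.mono hsub).comp continuousOn_snd fun z hz => hz.2
    have h3 : ContinuousOn (fun z : ℝ × ℝ => velocity B z.2) (Icc a b ×ˢ Icc a b) :=
      ((continuousOn_velocity hB).mono hsub).comp continuousOn_snd fun z hz => hz.2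
    have hKc : IsCompact K := by
      have h4 := ((h1.sub h2).inner (𝕜 := ℝ) h3).preimage_isClosed_of_isClosed hprod.isClosed
        (isClosed_singleton (x := (0 : ℝ)))
      have h5 := (continuous_dist.comp_continuousOn (h1.prodMk h2)).preimage_isClosed_of_isClosed
        hprod.isClosed (isClosed_Iic (a := r / 2))
      rw [hK]
      refine hprod.of_isClosed_subset ?_ fun z hz => hz.1
      convert h4.inter h5 using 1
      ext z
      constructor
      · rintro ⟨hz, hz1, hz2⟩
        exact ⟨⟨hz, hz1⟩, hz, hz2⟩
      · rintro ⟨⟨hz, hz1⟩, -, hz2⟩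
        exact ⟨hz, hz1, hz2⟩
    have himage : Prod.fst '' K = Icc a b := by
      rw [hK]
      ext u
      constructor
      · rintro ⟨z, hz, rfl⟩; exact hz.1.1
      · exact fun hu => ⟨(u, T u), ⟨⟨hu, hT u hu⟩, hTdisc u hu⟩, rfl⟩
    rw [← himage]
    refine continuousOn_image_of_comp hKc continuousOn_fst (continuousOn_snd.congr ?_)
    rw [hK]
    rintro z ⟨hz, hz1⟩
    exact huniq _ _ (hT _ hz.1) _ hz.2 (hTdisc _ hz.1) hz1
  -- Two points of the path in one normal plane would make no progress in the direction of its
  -- normal, against `hmono`.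
  have hTinj : InjOn T (Icc a b) := by
    have key : ∀ u ∈ Icc a b, ∀ v ∈ Icc a b, u < v → T u ≠ T v := by
      intro u hu v hv huv he
      have h1 := (hTdisc u hu).1
      have h2 := (hTdisc v hv).1
      have h3 := hmono (T u) (hT u hu) u hu v hv huv
      rw [← he] at h2
      have e : ℓ v - ℓ u = (ℓ v - B (T u)) - (ℓ u - B (T u)) := by abel
      rw [e, inner_sub_left, h1, h2] at h3
      norm_num at h3
    intro u hu v hv he
    rcases lt_trichotomy u v with h | h | h
    · exact absurd he (key u hu v hv h)
    · exact h
    · exact absurd he.symm (key v hv u hu h)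
  have hcentre : ∀ t, B t ∈ normalDisc B (r / 2) t := fun t => by
    constructor
    · simp
    · simpa using (half_pos hr).le
  have hTa : T a = a := huniq _ _ (hT a ha) _ ha (hTdisc a ha) (hℓa ▸ hcentre a)
  have hTb : T b = b := huniq _ _ (hT b hb) _ hb (hTdisc b hb) (hℓb ▸ hcentre b)
  have hTimage : T '' Icc a b = Icc a b := by
    refine Subset.antisymm (image_subset_iff.2 fun u hu => hT u hu) ?_
    have := intermediate_value_Icc hab hTcont
    rwa [hTa, hTb] at this
  obtain ⟨U, hU⟩ : ∃ U : ℝ → ℝ, ∀ u ∈ Icc a b, U (T u) = u :=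
    ⟨Function.invFunOn T (Icc a b), fun u hu => hTinj.leftInvOn_invFunOn hu⟩
  have hUcont : ContinuousOn U (Icc a b) := by
    rw [← hTimage]
    exact continuousOn_image_of_comp isCompact_Icc hTcont
      (continuousOn_id.congr fun u hu => hU u hu)
  have hUmem : ∀ t ∈ Icc a b, U t ∈ Icc a b ∧ T (U t) = t := by
    intro t ht
    rw [← hTimage] at ht
    obtain ⟨u, hu, rfl⟩ := ht
    rw [hU u hu]
    exact ⟨hu, rfl⟩
  have hw : ContinuousOn (fun t => ℓ (U t) - B t) (Icc a b) :=
    (hcont.comp hUcont fun t ht => (hUmem t ht).1).sub (hB.continuousOn.mono hsub)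
  have hproj : ∀ t ∈ Icc a b, (projIcc a b hab t : ℝ) = t := fun t ht => by
    rw [projIcc_of_mem hab ht]
  have hdisc : ∀ t ∈ Icc a b, ℓ (U t) ∈ normalDisc B (r / 2) t := fun t ht => by
    have := hTdisc _ (hUmem t ht).1
    rwa [(hUmem t ht).2] at this
  -- Extension by the end values, which are zero because the path and the arc have the same ends.
  refine ⟨fun t => ℓ (U (projIcc a b hab t)) - B (projIcc a b hab t), ?_, fun t ht => ?_,
    fun t ht => ?_, fun t ht => ?_, ?_⟩
  · exact hw.comp_continuous (continuous_subtype_val.comp continuous_projIcc) fun t => (projIcc a b hab t).2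
  · rcases le_or_gt t a with h | h
    · have hUa : U a = a := by simpa [hTa] using hU a ha
      simp [projIcc_of_le_left hab h, hUa, hℓa]
    · have h' : b ≤ t := by
        by_contra! hc; exact ht ⟨h, hc⟩
      have hUb : U b = b := by simpa [hTb] using hU b hb
      simp [projIcc_of_right_le hab h', hUb, hℓb]
  · simp only [hproj t ht]; exact (hdisc t ht).1
  · simp only [hproj t ht, ← dist_eq_norm]; exact (hdisc t ht).2
  · ext x
    constructor
    · rintro ⟨t, ht, rfl⟩
      exact ⟨U t, (hUmem t ht).1, by simp [hproj t ht]⟩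
    · rintro ⟨u, hu, rfl⟩
      exact ⟨T u, hT u hu, by simp [hproj _ (hT u hu), hU u hu]⟩

/-! ### Parametrized polygons and gluing of the segments -/

/-- The uniform parametrization of the polygon with vertices `q 0, …, q n` by `[0,n]`. -/
def plPath (n : ℕ) (q : ℕ → E3) (x : ℝ) : E3 :=
  q 0 + ∑ j ∈ Finset.range n, max 0 (min 1 (x - j)) • (q (j + 1) - q j)

theorem continuous_plPath (n : ℕ) (q : ℕ → E3) : Continuous (plPath n q) := by
  unfold plPath; fun_prop

theorem plPath_of_le {n : ℕ} (q : ℕ → E3) {x : ℝ} (hx : (n : ℝ) ≤ x) : plPath n q x = q n := by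
  induction n with
  | zero => simp [plPath]
  | succ n ih =>
    push_cast at hx
    have h := ih (by linarith)
    have h1 : max 0 (min 1 (x - n)) = 1 := by
      rw [min_eq_left (by linarith)]; norm_num
    rw [plPath] at h ⊢
    rw [Finset.sum_range_succ, ← add_assoc, h, h1]
    simp

theorem plPath_eq {n j : ℕ} (hj : j < n) (q : ℕ → E3) {x : ℝ} (hx : x ∈ Icc (j : ℝ) (j + 1)) :
    plPath n q x = q j + (x - j) • (q (j + 1) - q j) := by
  induction n, hj using Nat.le_induction with
  | base =>
    have h := plPath_of_le q hx.1
    rw [plPath] at h ⊢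
    rw [Finset.sum_range_succ, ← add_assoc, h, min_eq_right (by linarith [hx.2]),
      max_eq_right (by linarith [hx.1])]
  | succ n hn ih =>
    have hn' : (j : ℝ) + 1 ≤ n := by exact_mod_cast hn
    rw [plPath] at ih ⊢
    have h1 : max 0 (min 1 (x - n)) = 0 :=
      max_eq_left ((min_le_right _ _).trans (by linarith [hx.2]))
    rw [Finset.sum_range_succ, ← add_assoc, ih, h1, zero_smul, add_zero]

theorem exists_mem_Icc_nat {n : ℕ} (hn : 0 < n) {x : ℝ} (hx : x ∈ Icc (0 : ℝ) n) :
    ∃ j < n, x ∈ Icc (j : ℝ) (j + 1) := by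
  induction n, hn using Nat.le_induction with
  | base => exact ⟨0, by norm_num, by simpa using hx⟩
  | succ n hn ih =>
    rcases le_total x n with h | h
    · obtain ⟨j, hj, h1⟩ := ih ⟨hx.1, h⟩
      exact ⟨j, by omega, h1⟩
    · exact ⟨n, by omega, h, by simpa using hx.2⟩

theorem image_plPath {n : ℕ} (hn : 0 < n) (q : ℕ → E3) :
    plPath n q '' Icc 0 n = ⋃ j ∈ Finset.range n, segment ℝ (q j) (q (j + 1)) := by
  ext y
  simp only [mem_iUnion, Finset.mem_range, exists_prop, segment_eq_image']
  constructor
  · rintro ⟨x, hx, rfl⟩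
    obtain ⟨j, hj, h1⟩ := exists_mem_Icc_nat hn hx
    exact ⟨j, hj, x - j, ⟨by linarith [h1.1], by linarith [h1.2]⟩, (plPath_eq hj q h1).symm⟩
  · rintro ⟨j, hj, θ, hθ, rfl⟩
    have hj' : (j : ℝ) + 1 ≤ n := by exact_mod_cast hj
    refine ⟨j + θ, ⟨add_nonneg (Nat.cast_nonneg _) hθ.1, by linarith [hθ.2]⟩, ?_⟩
    rw [plPath_eq hj q ⟨by linarith [hθ.1], by linarith [hθ.2]⟩, add_sub_cancel_left]

/-- Every clamped coefficient is monotone in the parameter, and the one of the edge with number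
`⌊x⌋₊` increases strictly just after `x`. -/
theorem inner_plPath_sub_pos {n : ℕ} {q : ℕ → E3} {v : E3}
    (hv : ∀ j < n, 0 < inner ℝ (q (j + 1) - q j) v) {x y : ℝ} (hx : 0 ≤ x) (hxy : x < y)
    (hy : y ≤ n) : 0 < inner ℝ (plPath n q y - plPath n q x) v := by
  have e : plPath n q y - plPath n q x = ∑ j ∈ Finset.range n,
      (max 0 (min 1 (y - j)) - max 0 (min 1 (x - j))) • (q (j + 1) - q j) := by
    simp only [plPath, add_sub_add_left_eq_sub, ← Finset.sum_sub_distrib, sub_smul]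
  rw [e, sum_inner]
  simp only [real_inner_smul_left]
  obtain ⟨j, hj, hjx⟩ : ∃ j < n, x ∈ Ico (j : ℝ) (j + 1) := by
    refine ⟨⌊x⌋₊, ?_, Nat.floor_le hx, Nat.lt_floor_add_one x⟩
    exact (Nat.floor_lt hx).2 (hxy.trans_le hy)
  refine Finset.sum_pos' (fun i hi => ?_) ⟨j, Finset.mem_range.2 hj, ?_⟩
  · refine mul_nonneg (sub_nonneg.2 ?_) (hv i (Finset.mem_range.1 hi)).le
    gcongr
  · refine mul_pos (sub_pos.2 ?_) (hv j hj)
    rw [min_eq_right (by linarith [hjx.2] : x - j ≤ 1), max_eq_right (by linarith [hjx.1])]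
    exact lt_max_of_lt_right (lt_min (by linarith [hjx.2]) (by linarith))

theorem bezier_zero (n : ℕ) (q : ℕ → E3) : bezier n q 0 = q 0 := by
  rw [bezier, Finset.sum_range_succ']
  simp

theorem bezier_one (n : ℕ) (q : ℕ → E3) : bezier n q 1 = q n := by
  rw [bezier, Finset.sum_range_succ, Finset.sum_eq_zero, zero_add]
  · simp
  · intro j hj
    have : n - j ≠ 0 := by have := Finset.mem_range.1 hj; omega
    simp [this]

/-- A composite control polygon is ambient isotopic to its curve if it is contained in the pipe and
the edges of each of its parts pairwise make acute angles. -/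
theorem ambientIsotopic_plCurve {m n : ℕ} {τ : ℕ → ℝ} {Q : ℕ → ℕ → E3} {B : ℝ → E3} {r : ℝ}
    (h : IsCompositeBezier m (n + 1) τ Q B) (hC1 : ContDiffOn ℝ 1 B (Icc 0 1))
    (hreg : IsRegularCurve B) (hsimple : IsSimpleCurve B) (hr : 0 < r)
    (hpipe : PipeNonSelfIntersecting B r)
    (hpos : ∀ k < m, ∀ j ≤ n, ∀ l ≤ n,
      0 < inner ℝ (discreteDeriv (n + 1) τ Q k j) (discreteDeriv (n + 1) τ Q k l))
    (hdist : ∀ k < m, ∀ u ∈ Icc (0 : ℝ) 1,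
      dist (plPath (n + 1) (Q k) ((n + 1 : ℕ) * u)) (bezier (n + 1) (Q k) u) ≤ r / 2) :
    AmbientIsotopic (plCurve m (n + 1) Q) (B '' Icc 0 1) := by
  have hpiece : ∀ k < m, ∃ w : ℝ → E3, Continuous w ∧ (∀ t ∉ Ioo (τ k) (τ (k + 1)), w t = 0) ∧
      (∀ t ∈ Icc (τ k) (τ (k + 1)), inner ℝ (w t) (velocity B t) = 0) ∧
      (∀ t ∈ Icc (τ k) (τ (k + 1)), ‖w t‖ ≤ r / 2) ∧
      (fun t => B t + w t) '' Icc (τ k) (τ (k + 1)) =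
        ⋃ j ∈ Finset.range (n + 1), segment ℝ (Q k j) (Q k (j + 1)) := by
    intro k hk
    have hlt := h.knot_lt k hk
    have hlen : 0 < τ (k + 1) - τ k := sub_pos.2 hlt
    have hn : (0 : ℝ) < (n + 1 : ℕ) := by positivity
    have hparam : ∀ t ∈ Icc (τ k) (τ (k + 1)), (t - τ k) / (τ (k + 1) - τ k) ∈ Icc (0 : ℝ) 1 :=
      fun t ht => ⟨div_nonneg (by linarith [ht.1]) hlen.le,
        (div_le_one hlen).2 (by linarith [ht.2])⟩
    -- The velocity is a convex combination of the vectors of the discrete derivative, all of which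
    -- lie in the open half-space defined by any one of them.
    have hvelD : ∀ t ∈ Icc (τ k) (τ (k + 1)), ∀ j ≤ n,
        0 < inner ℝ (discreteDeriv (n + 1) τ Q k j) (velocity B t) := by
      intro t ht j hj
      rw [h.velocity_eq hC1 hk ht]
      exact bezier_mem_of_convex
        (convex_halfSpace_gt (innerSL ℝ (discreteDeriv (n + 1) τ Q k j)).isLinear 0)
        (fun l hl => hpos k hk j hj l hl) (hparam t ht)
    have hvel : ∀ s ∈ Icc (τ k) (τ (k + 1)), ∀ t ∈ Icc (τ k) (τ (k + 1)),
        0 < inner ℝ (velocity B s) (velocity B t) := by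
      intro s hs t ht
      rw [h.velocity_eq hC1 hk hs, real_inner_comm]
      refine bezier_mem_of_convex
        (convex_halfSpace_gt (innerSL ℝ (velocity B t)).isLinear 0)
        (fun l hl => ?_) (hparam s hs)
      change 0 < inner ℝ (velocity B t) _
      rw [real_inner_comm]
      exact hvelD t ht l hl
    have hedge : ∀ t ∈ Icc (τ k) (τ (k + 1)), ∀ j < n + 1,
        0 < inner ℝ (Q k (j + 1) - Q k j) (velocity B t) := by
      intro t ht j hj
      have h1 := hvelD t ht j (Nat.lt_succ_iff.1 hj)
      rw [discreteDeriv, real_inner_smul_left] at h1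
      exact (mul_pos_iff_of_pos_left (inv_pos.2 (div_pos hlen hn))).1 h1
    obtain ⟨w, h1, h2, h3, h4, h5⟩ := exists_normalField_of_path
      (ℓ := fun u => plPath (n + 1) (Q k) ((n + 1 : ℕ) * ((u - τ k) / (τ (k + 1) - τ k))))
      hC1 hr hpipe hlt.le (h.Icc_subset hk) hvel
      ((continuous_plPath _ _).comp (by fun_prop)).continuousOn
      (fun t ht u hu v hv huv => inner_plPath_sub_pos (hedge t ht)
        (mul_nonneg hn.le (hparam u hu).1) (by gcongr)
        (mul_le_of_le_one_right hn.le (hparam v hv).2))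
      (by
        rw [h.eq_bezier k hk _ ⟨le_rfl, hlt.le⟩, sub_self, zero_div, mul_zero, bezier_zero,
          plPath_eq (Nat.succ_pos n) _ (by simp)]
        simp)
      (by
        rw [h.eq_bezier k hk _ ⟨hlt.le, le_rfl⟩, div_self hlen.ne', mul_one, bezier_one,
          plPath_of_le _ le_rfl])
      (fun u hu => by
        rw [h.eq_bezier k hk u hu]
        exact hdist k hk _ (hparam u hu))
    refine ⟨w, h1, h2, h3, h4, h5.trans ?_⟩
    rw [← image_plPath (Nat.succ_pos n)]
    ext y
    constructor
    · rintro ⟨u, hu, rfl⟩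
      exact ⟨_, ⟨mul_nonneg hn.le (hparam u hu).1, mul_le_of_le_one_right hn.le (hparam u hu).2⟩,
        rfl⟩
    · rintro ⟨x, hx, rfl⟩
      have hx1 : x / (n + 1 : ℕ) ≤ 1 := (div_le_one hn).2 hx.2
      have hx0 : 0 ≤ x / (n + 1 : ℕ) := div_nonneg hx.1 hn.le
      refine ⟨τ k + x / (n + 1 : ℕ) * (τ (k + 1) - τ k), ⟨?_, ?_⟩, ?_⟩
      · linarith [mul_nonneg hx0 hlen.le]
      · linarith [mul_le_of_le_one_left hlen.le hx1]
      · simp only [add_sub_cancel_left]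
        rw [mul_div_cancel_right₀ _ hlen.ne', mul_div_cancel₀ _ hn.ne']
  choose! w hcont hzero hnormal hnorm himage using hpiece
  -- The fields have disjoint open supports and vanish at the knots, so their sum glues them.
  have hsum : ∀ k < m, ∀ t ∈ Icc (τ k) (τ (k + 1)), ∑ l ∈ Finset.range m, w l t = w k t := by
    intro k hk t ht
    refine Finset.sum_eq_single_of_mem k (Finset.mem_range.2 hk) fun l hl hne => ?_
    have hl := Finset.mem_range.1 hl
    refine hzero l hl t fun hmem => ?_
    rcases lt_or_gt_of_ne hne with h1 | h1
    · have := h.knot_mono (show l + 1 ≤ k from h1) hk.le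
      linarith [hmem.2, ht.1]
    · have := h.knot_mono (show k + 1 ≤ l from h1) hl.le
      linarith [hmem.1, ht.2]
  have hends : ∀ k < m, ∀ t, t = 0 ∨ t = 1 → w k t = 0 := by
    intro k hk t ht
    refine hzero k hk t fun hmem => ?_
    have h1 := h.Icc_subset hk ⟨le_rfl, (h.knot_lt k hk).le⟩
    have h2 := h.Icc_subset hk ⟨(h.knot_lt k hk).le, le_rfl⟩
    rcases ht with rfl | rfl
    · linarith [hmem.1, h1.1]
    · linarith [hmem.2, h2.2]
  have hfield : ShortNormalField B (fun t => ∑ l ∈ Finset.range m, w l t) r := by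
    refine ⟨hC1, hreg, hsimple, hr, hpipe, ?_, fun t ht => ?_, fun t ht => ?_, ?_, ?_⟩
    · exact continuousOn_finsetSum _ fun l hl => (hcont l (Finset.mem_range.1 hl)).continuousOn
    · obtain ⟨k, hk, hkt⟩ := h.exists_mem_Icc ht
      rw [hsum k hk t hkt]; exact hnormal k hk t hkt
    · obtain ⟨k, hk, hkt⟩ := h.exists_mem_Icc ht
      rw [hsum k hk t hkt]; exact hnorm k hk t hkt
    · exact Finset.sum_eq_zero fun l hl => hends l (Finset.mem_range.1 hl) 0 (Or.inl rfl)
    · exact Finset.sum_eq_zero fun l hl => hends l (Finset.mem_range.1 hl) 1 (Or.inr rfl)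
  have hcurve : plCurve m (n + 1) Q =
      (fun t => B t + ∑ l ∈ Finset.range m, w l t) '' Icc 0 1 := by
    ext y
    simp only [plCurve, mem_iUnion₂ (s := fun k (_ : k ∈ Finset.range m) =>
      ⋃ j ∈ Finset.range (n + 1), segment ℝ (Q k j) (Q k (j + 1)))]
    constructor
    · rintro ⟨k, hk, hy⟩
      have hk := Finset.mem_range.1 hk
      rw [← himage k hk] at hy
      obtain ⟨t, ht, rfl⟩ := hy
      exact ⟨t, h.Icc_subset hk ht, by simp only [hsum k hk t ht]⟩
    · rintro ⟨t, ht, rfl⟩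
      obtain ⟨k, hk, hkt⟩ := h.exists_mem_Icc ht
      refine ⟨k, Finset.mem_range.2 hk, ?_⟩
      rw [← himage k hk]
      exact ⟨t, hkt, by simp only [hsum k hk t hkt]⟩
  rw [hcurve]
  exact hfield.ambientIsotopic

/-! ### Angles between the edges of a polygon -/

open InnerProductGeometry in
-- By the law of cosines `2 ‖x‖ ‖y‖ (1 - cos (angle x y)) ≤ ‖y - x‖ ^ 2`, and the right side is at
-- most `(1 - cos ν) s ^ 2 / 2` because `1 - cos ν ≤ 2`; this is less than `2 (1 - cos ν) ‖x‖ ‖y‖`.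
theorem angle_lt_of_norm_sub_le {x y : E3} {s ν : ℝ} (hs : 0 < s) (hx : s ≤ ‖x‖) (hy : s ≤ ‖y‖)
    (hν : 0 < ν) (hνπ : ν ≤ Real.pi) (hxy : ‖y - x‖ ≤ (1 - Real.cos ν) * s / 2) :
    angle x y < ν := by
  have hcos : Real.cos ν < 1 := by
    simpa using Real.cos_lt_cos_of_nonneg_of_le_pi le_rfl hνπ hν
  have hcos' := Real.neg_one_le_cos ν
  have hxpos : 0 < ‖x‖ := hs.trans_le hx
  have hypos : 0 < ‖y‖ := hs.trans_le hy
  rw [← Real.strictAntiOn_cos.lt_iff_gt ⟨hν.le, hνπ⟩ ⟨angle_nonneg _ _, angle_le_pi _ _⟩, cos_angle,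
    lt_div_iff₀ (mul_pos hxpos hypos)]
  have h1 := norm_sub_sq_real y x
  have h2 : ‖y - x‖ ^ 2 ≤ ((1 - Real.cos ν) * s / 2) ^ 2 :=
    pow_le_pow_left₀ (norm_nonneg _) hxy 2
  have h3 : s * s ≤ ‖x‖ * ‖y‖ := mul_le_mul hx hy hs.le hxpos.le
  have h4 : (1 - Real.cos ν) * (s * s) ≤ (1 - Real.cos ν) * (‖x‖ * ‖y‖) :=
    mul_le_mul_of_nonneg_left h3 (by linarith)
  have h5 : (1 - Real.cos ν) * ((1 - Real.cos ν) * (s * s)) ≤ 2 * ((1 - Real.cos ν) * (s * s)) :=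
    mul_le_mul_of_nonneg_right (by linarith)
      (mul_nonneg (by linarith) (mul_self_nonneg s))
  have h6 : 0 < (1 - Real.cos ν) * (s * s) := mul_pos (by linarith) (mul_pos hs hs)
  rw [real_inner_comm] at h1
  linarith [sq_nonneg (‖x‖ - ‖y‖)]

open InnerProductGeometry in
-- The triangle inequality for angles adds up at most `n` steps, each of angle strictly less than
-- `ν`, so every total stays below `π / 2`.
theorem inner_pos_of_norm_sub_le {n : ℕ} {v : ℕ → E3} {s ν : ℝ} (hs : 0 < s)
    (hv : ∀ j ≤ n, s ≤ ‖v j‖) (hν : 0 < ν) (hνn : n * ν ≤ Real.pi / 2) (hνπ : ν ≤ Real.pi)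
    (hstep : ∀ j < n, ‖v (j + 1) - v j‖ ≤ (1 - Real.cos ν) * s / 2) {j l : ℕ} (hj : j ≤ n)
    (hl : l ≤ n) : 0 < inner ℝ (v j) (v l) := by
  have hangle : ∀ j i, j + i ≤ n → 0 < i → angle (v j) (v (j + i)) < i * ν := by
    intro j i
    induction i with
    | zero => intro _ h; exact absurd h (lt_irrefl 0)
    | succ i ih =>
      intro hi _
      have h1 := angle_lt_of_norm_sub_le hs (hv (j + i) (by omega)) (hv (j + i + 1) (by omega))
        hν hνπ (hstep (j + i) (by omega))
      rcases Nat.eq_zero_or_pos i with rfl | h0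
      · simpa using h1
      · have h2 := ih (by omega) h0
        have h3 := angle_le_angle_add_angle (v j) (v (j + i)) (v (j + i + 1))
        push_cast
        rw [← add_assoc]
        linarith
  have hlt : ∀ j i, j + i ≤ n → 0 < i → 0 < inner ℝ (v j) (v (j + i)) := by
    intro j i hi h0
    have h1 : angle (v j) (v (j + i)) < Real.pi / 2 := by
      refine (hangle j i hi h0).trans_le (le_trans ?_ hνn)
      have : (i : ℝ) ≤ n := by exact_mod_cast (by omega : i ≤ n)
      gcongr
    rw [← cos_angle_mul_norm_mul_norm]
    have h2 := hs.trans_le (hv j (by omega))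
    have h3 := hs.trans_le (hv (j + i) hi)
    have h4 := Real.cos_pos_of_mem_Ioo
      ⟨by linarith [angle_nonneg (v j) (v (j + i)), Real.pi_pos], h1⟩
    positivity
  rcases lt_trichotomy j l with h | rfl | h
  · obtain ⟨i, rfl⟩ := Nat.exists_eq_add_of_lt h
    exact hlt j (i + 1) hl (Nat.succ_pos i)
  · rw [real_inner_self_eq_norm_sq]
    have := hs.trans_le (hv j hj)
    positivity
  · obtain ⟨i, rfl⟩ := Nat.exists_eq_add_of_lt h
    rw [real_inner_comm]
    exact hlt l (i + 1) hj (Nat.succ_pos i)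

/-! ### The constants and the number of subdivisions -/

theorem abs_le_delta2 {m d : ℕ} (Q : ℕ → ℕ → E3) {k j : ℕ} (hk : k < m) (hj : j + 2 ≤ d)
    (c : Fin 3) : |Q k j c - 2 * Q k (j + 1) c + Q k (j + 2) c| ≤ delta2 m d Q c :=
  le_ciSup_of_le (finite_range fun k : Fin m => ⨆ j : Fin (d - 1),
      |Q k j c - 2 * Q k (j + 1) c + Q k (j + 2) c|).bddAbove ⟨k, hk⟩
    (le_ciSup (finite_range fun j : Fin (d - 1) =>
      |Q k j c - 2 * Q k (j + 1) c + Q k (j + 2) c|).bddAbove ⟨j, by omega⟩)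

theorem delta2_nonneg (m d : ℕ) (Q : ℕ → ℕ → E3) (c : Fin 3) : 0 ≤ delta2 m d Q c :=
  Real.iSup_nonneg fun _ => Real.iSup_nonneg fun _ => abs_nonneg _

theorem norm_step_le_maxStep {m n : ℕ} (τ : ℕ → ℝ) (p : ℕ → ℕ → E3) {k j : ℕ} (hk : k < m)
    (hj : j + 1 < n) :
    ‖discreteDeriv n τ p k (j + 1) - discreteDeriv n τ p k j‖ ≤ maxStep m n τ p :=
  le_ciSup_of_le (finite_range fun k : Fin m => ⨆ j : Fin (n - 1),
      ‖discreteDeriv n τ p k (j + 1) - discreteDeriv n τ p k j‖).bddAbove ⟨k, hk⟩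
    (le_ciSup (finite_range fun j : Fin (n - 1) =>
      ‖discreteDeriv n τ p k (j + 1) - discreteDeriv n τ p k j‖).bddAbove ⟨j, by omega⟩)

theorem edges_edges_apply (Q : ℕ → ℕ → E3) (k j : ℕ) (c : Fin 3) :
    edges (edges Q) k j c = Q k j c - 2 * Q k (j + 1) c + Q k (j + 2) c := by
  change Q k (j + 2) c - Q k (j + 1) c - (Q k (j + 1) c - Q k j c) = _
  ring

theorem differenceBounds (m n : ℕ) (τ : ℕ → ℝ) (p : ℕ → ℕ → E3) :
    DifferenceBounds m n τ p (delta2 m (n + 3) p) (delta2 m (n + 2) (discreteDeriv (n + 3) τ p))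
      (maxStep m (n + 3) τ p) := by
  refine ⟨fun k hk j hj c => ?_, fun k hk j hj c => ?_, fun k hk j hj => ?_⟩
  · rw [edges_edges_apply]; exact abs_le_delta2 p hk (by omega) c
  · rw [edges_edges_apply]; exact abs_le_delta2 _ hk (by omega) c
  · exact norm_step_le_maxStep τ p hk (by omega)

theorem le_rpow_of_logb_le {x y : ℝ} (hy : 0 ≤ y) (h : Real.logb 2 y ≤ x) : y ≤ 2 ^ x := by
  -- For `y = 0` the default value of the logarithm plays no role, as powers of 2 are positive.
  rcases hy.eq_or_lt with rfl | h0
  · positivity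
  · exact (Real.logb_le_iff_le_rpow one_lt_two h0).1 h

theorem two_rpow_two_mul_natCast (i : ℕ) : (2 : ℝ) ^ (2 * (i : ℝ)) = 4 ^ i := by
  rw [Real.rpow_mul two_pos.le, Real.rpow_natCast]; norm_num

theorem Ninfty_nonneg (d : ℕ) : 0 ≤ Ninfty d := by rw [Ninfty_eq]; positivity

theorem derivDist_antitone (m n : ℕ) (τ : ℕ → ℝ) (p : ℕ → ℕ → E3) :
    Antitone (derivDist m n τ p) := by
  intro x y hxy
  have := Ninfty_nonneg (n - 1)
  unfold derivDist
  gcongr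
  norm_num

theorem isotopic_of_bounds {m n : ℕ} {τ : ℕ → ℝ} {p : ℕ → ℕ → E3} {B : ℝ → E3} {r s : ℝ} {i : ℕ}
    (hB : IsCompositeBezier m (n + 3) τ p B) (hC1 : ContDiffOn ℝ 1 B (Icc 0 1))
    (hreg : IsRegularCurve B) (hsimple : IsSimpleCurve B) (hr : 0 < r)
    (hpipe : PipeNonSelfIntersecting B r) (hs : 0 < s)
    (hdist : Ninfty (n + 3) * ‖delta2 m (n + 3) p‖ / 4 ^ i ≤ r / 2)
    (hspeed : s ≤ minSpeed B - derivDist m (n + 3) τ p i)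
    (hstep : maxStep m (n + 3) τ p / 2 ^ i ≤
      (1 - Real.cos (Real.pi / (2 * ((n : ℝ) + 2)))) * s / 2) :
    AmbientIsotopic (controlPolygon m (n + 3) p i) (B '' Icc 0 1) := by
  obtain ⟨τ', h, hb⟩ := exists_refinement hB (differenceBounds m n τ p) i
  have hscale : ∀ (δ : E3) (c : Fin 3), ((1 / 4 ^ i : ℝ) • δ) c = δ c / 4 ^ i := fun δ c => by
    rw [PiLp.smul_apply, smul_eq_mul, one_div, inv_mul_eq_div]
  have hscale_norm : ∀ δ : E3, ‖(1 / 4 ^ i : ℝ) • δ‖ = ‖δ‖ / 4 ^ i := fun δ => by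
    rw [norm_smul, Real.norm_eq_abs, abs_of_pos (by positivity), one_div, inv_mul_eq_div]
  have hν : 0 < Real.pi / (2 * ((n : ℝ) + 2)) := by positivity
  refine ambientIsotopic_plCurve h hC1 hreg hsimple hr hpipe (fun k hk j hj l hl => ?_)
    fun k hk u hu => ?_
  · refine inner_pos_of_norm_sub_le (n := n + 2) hs (fun j hj => ?_) hν ?_ ?_ (fun j hj => ?_) hj hl
    · have hlt := h.knot_lt k hk
      -- The vertex `j` of the discrete derivative is compared with the velocity at the matching
      -- parameter, whose norm is at least `σ`.
      have h1 := norm_bezier_sub_vertex_le (q := discreteDeriv (n + 3) τ'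
        ((subdivide (n + 3))^[i] p) k)
        (δ := (1 / 4 ^ i : ℝ) • delta2 m (n + 2) (discreteDeriv (n + 3) τ p)) hj (by omega)
        (fun a ha c => by
          rw [hscale, ← edges_edges_apply]
          exact hb.deriv k hk a (by omega) c)
        fun c => by
          rw [hscale]
          exact div_nonneg (delta2_nonneg _ _ _ _) (by positivity)
      have hj1 : (j / (n + 2 : ℕ) : ℝ) ≤ 1 := by
        rw [div_le_one (by positivity)]; exact_mod_cast hj
      have hj0 : (0 : ℝ) ≤ j / (n + 2 : ℕ) := by positivity
      obtain ⟨t, ht⟩ : ∃ t, t = τ' k + j / (n + 2 : ℕ) * (τ' (k + 1) - τ' k) := ⟨_, rfl⟩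
      have hlen := sub_pos.2 hlt
      have htmem : t ∈ Icc (τ' k) (τ' (k + 1)) := by
        rw [ht]
        constructor
        · linarith [mul_nonneg hj0 hlen.le]
        · linarith [mul_le_of_le_one_left hlen.le hj1]
      have hvel := h.velocity_eq hC1 hk htmem
      have hu : (t - τ' k) / (τ' (k + 1) - τ' k) = j / (n + 2 : ℕ) := by
        rw [ht, add_sub_cancel_left, mul_div_cancel_right₀ _ hlen.ne']
      rw [hu] at hvel
      rw [← hvel, hscale_norm] at h1
      have h2 : minSpeed B ≤ ‖velocity B t‖ :=
        csInf_le ⟨0, by rintro _ ⟨x, -, rfl⟩; exact norm_nonneg _⟩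
          ⟨t, h.Icc_subset hk htmem, rfl⟩
      have h3 : derivDist m (n + 3) τ p i =
          Ninfty (n + 2) * (‖delta2 m (n + 2) (discreteDeriv (n + 3) τ p)‖ / 4 ^ i) := by
        rw [derivDist, two_rpow_two_mul_natCast, Nat.add_sub_cancel (n + 2) 1]
        ring
      have h4 := norm_sub_norm_le (velocity B t)
        (discreteDeriv (n + 3) τ' ((subdivide (n + 3))^[i] p) k j)
      linarith
    · push_cast
      apply le_of_eq
      field_simp
    · refine div_le_self Real.pi_pos.le ?_
      have : (0 : ℝ) ≤ n := Nat.cast_nonneg n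
      linarith
    · exact (hb.step k hk j (by omega)).trans hstep
  · have hx : ((n + 2 + 1 : ℕ) : ℝ) * u ∈ Icc (0 : ℝ) (n + 2 + 1 : ℕ) :=
      ⟨mul_nonneg (Nat.cast_nonneg _) hu.1, mul_le_of_le_one_right (Nat.cast_nonneg _) hu.2⟩
    obtain ⟨j, hj, hxj⟩ := exists_mem_Icc_nat (Nat.succ_pos _) hx
    rw [plPath_eq hj _ hxj, dist_comm, dist_eq_norm]
    refine (norm_bezier_sub_line_le (δ := (1 / 4 ^ i : ℝ) • delta2 m (n + 3) p) hj
      (fun a ha c => ?_) (fun c => ?_) hu hxj).trans ?_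
    · rw [hscale, ← edges_edges_apply]
      exact hb.polygon k hk a (by omega) c
    · rw [hscale]
      exact div_nonneg (delta2_nonneg _ _ _ _) (by positivity)
    · rw [hscale_norm, ← mul_div_assoc]
      exact hdist

end BezierIsotopy

theorem mainTheorem4 (m n : ℕ) (hn : 3 ≤ n) (τ : ℕ → ℝ) (p : ℕ → ℕ → BezierIsotopy.E3)
    (B : ℝ → BezierIsotopy.E3)
    (hB : BezierIsotopy.IsCompositeBezier m n τ p B)
    (hC1 : ContDiffOn ℝ 1 B (Set.Icc 0 1))
    (hreg : BezierIsotopy.IsRegularCurve B)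
    (hsimple : BezierIsotopy.IsSimpleCurve B)
    (r : ℝ) (hr : 0 < r) (hpipe : BezierIsotopy.PipeNonSelfIntersecting B r)
    (N₁ : ℝ) (hN₁ : BezierIsotopy.derivDist m n τ p N₁ < BezierIsotopy.minSpeed B)
    (i : ℕ) (hi : ⌈BezierIsotopy.NStar m n τ p B r N₁⌉ ≤ (i : ℤ)) :
    BezierIsotopy.AmbientIsotopic (BezierIsotopy.controlPolygon m n p i) (B '' Set.Icc 0 1) := by
  open BezierIsotopy in
  obtain ⟨n, rfl⟩ := Nat.exists_eq_add_of_le' hn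
  have hN : NStar m (n + 3) τ p B r N₁ ≤ i := by
    have := Int.ceil_le.1 hi
    exact_mod_cast this
  have hangle := (le_max_left _ _).trans hN
  have hpipe' := ((le_max_left _ _).trans (le_max_right _ _)).trans hN
  have hmax := (Int.le_ceil _).trans hangle
  have hcast : ((n + 3 : ℕ) : ℝ) - 1 = n + 2 := by push_cast; ring
  rw [hcast] at hmax
  have hN₁i : N₁ ≤ i := (le_max_left _ _).trans hmax
  have hlog := (le_max_right _ _).trans hmax
  have hs : 0 < minSpeed B - derivDist m (n + 3) τ p N₁ := sub_pos.2 hN₁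
  have hcos : Real.cos (Real.pi / (2 * ((n : ℝ) + 2))) < 1 := by
    have h1 : Real.pi / (2 * ((n : ℝ) + 2)) ≤ Real.pi := by
      refine div_le_self Real.pi_pos.le ?_
      have : (0 : ℝ) ≤ n := Nat.cast_nonneg n
      linarith
    have h2 : 0 < Real.pi / (2 * ((n : ℝ) + 2)) := by positivity
    simpa using Real.cos_lt_cos_of_nonneg_of_le_pi le_rfl h1 h2
  have hcos' := sub_pos.2 hcos
  -- The lower bound for the lengths is the one at `N₁`, which is the constant in `fAngle`; by
  -- monotonicity of `derivDist` and `N₁ ≤ i` it is still valid after `i` subdivisions.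
  refine isotopic_of_bounds hB hC1 hreg hsimple hr hpipe hs ?_
    (sub_le_sub_left (derivDist_antitone m (n + 3) τ p hN₁i) _) ?_
  · have h1 : 0 ≤ Ninfty (n + 3) * ‖delta2 m (n + 3) p‖ / (r / 2) := by
      have := Ninfty_nonneg (n + 3)
      positivity
    rw [NPipe] at hpipe'
    -- The factor `1 / 2` in `NPipe` turns `2 ^ i` into `4 ^ i`, the decay rate of second
    -- differences.
    have h2 := le_rpow_of_logb_le (x := 2 * (i : ℝ)) h1 (by linarith)
    rw [two_rpow_two_mul_natCast, div_le_iff₀ (by positivity)] at h2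
    rw [div_le_iff₀ (by positivity)]
    linarith
  · have hM : 0 ≤ maxStep m (n + 3) τ p :=
      Real.iSup_nonneg fun _ => Real.iSup_nonneg fun _ => norm_nonneg _
    have h1 : 0 ≤ fAngle m (n + 3) τ p B N₁ (Real.pi / (2 * ((n : ℝ) + 2))) :=
      div_nonneg (by positivity) (mul_pos hcos' hs).le
    have h2 := le_rpow_of_logb_le h1 hlog
    rw [Real.rpow_natCast, fAngle, div_le_iff₀ (mul_pos hcos' hs)] at h2
    rw [div_le_iff₀ (by positivity)]
    linarith
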